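/- **Setting.** Let $d,p\ge 1$, let $\mathcal A\subset\mathbb R^p$ be open and convex (the admissible states), let $f_1,\dots,f_d:\mathbb R^p\to\mathbb R^p$ be fluxes that are $C^1$ on $\mathcal A$, and let $(s,f^\epsilon)$ be an entropy pair: $s$ is convex and $C^1$ on $\mathcal A$, $f^\epsilon_1,\dots,f^\epsilon_d$ are real-valued and $C^1$ on $\mathcal A$, and $Df^\epsilon_i(\omega)=w(\omega)^TDf_i(\omega)$ on $\mathcal A$, where $w=\partial s/\partial\omega$ are the entropy variables. Write $w_u=w(u)$, $w_v=w(v)$. Let $\Omega_u,\Omega_v\subset\mathbb R^d$ be bounded open sets with disjoint boundaries. Each has finite $(d-1)$-dimensional boundary measure $dS$ (normalized Hausdorff measure $\mathcal H^{d-1}$) and an outward unit normal $\hat n$, in the sense that the distributional gradient of $1_{\Omega}$ is $-\hat n\,\mathcal H^{d-1}|_{\partial\Omega}$. Put $\Omega=\Omega_u\cup\Omega_v$ and $\Omega_O=\Omega_u\cap\Omega_v$. The physical boundaries are $\Gamma_a=\partial\Omega_u\setminus\Omega_v$ and $\Gamma_d=\partial\Omega_v\setminus\Omega_u$. The artificial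 interfaces are $\Gamma_b=\partial\Omega_v\cap\Omega_u$ and $\Gamma_c=\partial\Omega_u\cap\Omega_v$. The normals $\hat n_a,\hat n_c$ point out of $\Omega_u$, and $\hat n_b,\hat n_d$ point out of $\Omega_v$. Let $0<\eta<1$ and $T>0$. **Penalties.** For $\alpha=b,c$ the interface penalties are $\mathcal P^\alpha_u=\sum_i(\hat n_\alpha)_i\mathcal P^\alpha_{i,u}(u,v)$ and $\mathcal P^\alpha_v=\sum_i(\hat n_\alpha)_i\mathcal P^\alpha_{i,v}(u,v)$, with $\mathcal P^\alpha_{i,u},\mathcal P^\alpha_{i,v}$ continuous on $\mathcal A\times\mathcal A$ and zero when both arguments agree. The interior penalties are given by points $x^1,\dots,x^M\in\Omega_O$ and positive definite matrices $\Sigma^m_u,\Sigma^m_v\in\mathbb R^{p\times p}$ ($y^T\Sigma y>0$ for $y\ne0$; symmetry is not required; the matrices may depend on $t$) such that $$(1-\eta)\Sigma_u^m=\eta\,\Sigma_v^m\qquad(1\le m\le M,\ t\in[0,T]).$$ **Overset problem.** Let $u,v$ be $C^1$ in a neighbourhood of $[0,T]\times\overline{\Omega_u}$, resp. $[0,T]\times\overline{\Omega_v}$,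 with values in $\mathcal A$ on these sets. Let $\mathcal T_u,\mathcal T_v$ be linear spaces of $\mathbb R^p$-valued test functions $\phi(t,x)$ that are continuous in $x$ on $\overline{\Omega_u}$, resp. $\overline{\Omega_v}$. Assume that they contain all constants and that $w_u\in\mathcal T_u$, $w_v\in\mathcal T_v$. Suppose that for all $t\in[0,T]$, $\phi_u\in\mathcal T_u$, $\phi_v\in\mathcal T_v$ $$\int_{\Omega_u}\phi_u^T\Big(\partial_tu+\sum_i\partial_{x_i}f_i(u)\Big)dx+\int_{\Gamma_b}\phi_u^T\mathcal P_u^b\,dS+\int_{\Gamma_c}\phi_u^T\mathcal P_u^c\,dS+\frac1M\sum_{m=1}^M\big[\phi_u^T\Sigma_u^m(w_u-w_v)\big]_{x^m}=0,$$ $$\int_{\Omega_v}\phi_v^T\Big(\partial_tv+\sum_i\partial_{x_i}f_i(v)\Big)dx+\int_{\Gamma_b}\phi_v^T\mathcal P_v^b\,dS+\int_{\Gamma_c}\phi_v^T\mathcal P_v^c\,dS+\frac1M\sum_{m=1}^M\big[\phi_v^T\Sigma_v^m(w_v-w_u)\big]_{x^m}=0,$$ and that the same two equations hold with $\Omega_u$,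 resp. $\Omega_v$, replaced by $\Omega_O$ and without the interface terms (the interface penalties are not applied to the overlap region). If $M=0$, the sums are absent. **Quantities.** Let $S=(1-\eta)s(u)+\eta s(v)$ on $\Omega_O$, $S=s(u)$ on $\Omega_u\setminus\Omega_v$, $S=s(v)$ on $\Omega_v\setminus\Omega_u$, and $\bar S(t)=\int_\Omega S\,dx$. Put $$\mathcal P^m=\big[(1-\eta)w_u^T\Sigma_u^m(w_u-w_v)+\eta\,w_v^T\Sigma_v^m(w_v-w_u)\big]_{x^m},\qquad \mathcal D=\frac1M\sum_{m=1}^M\mathcal P^m,$$ $$F^\epsilon(t)=\int_{\Gamma_a}f^\epsilon(u)\cdot\hat n_a\,dS+\int_{\Gamma_d}f^\epsilon(v)\cdot\hat n_d\,dS .$$ Let $\beta=-\eta$ on $\Gamma_b$ and $\beta=1-\eta$ on $\Gamma_c$. On each interface let $$\mathcal B=\beta\,(f^\epsilon(u)-f^\epsilon(v))\cdot\hat n+w_u^T\mathcal P_u+w_v^T\mathcal P_v,\qquad \mathcal C=\beta\,(f(u)-f(v))\cdot\hat n+\mathcal P_u+\mathcal P_v .$$ **Claim.** For all $t\in[0,T]$: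 1. For every $m$, $\mathcal P^m=(1-\eta)\big[(w_u-w_v)^T\Sigma_u^m(w_u-w_v)\big]_{x^m}\ge0$. 2. (Entropy bound.) If $\mathcal B\ge0$ almost everywhere on $\Gamma_b$ and $\Gamma_c$ at all times in $[0,T]$, then $\bar S$ is differentiable with $\frac{d\bar S}{dt}+\mathcal D\le-F^\epsilon(t)$ and hence $\frac{d\bar S}{dt}\le-F^\epsilon(t)$. Consequently $\bar S(t)\le\bar S(0)-\int_0^tF^\epsilon(\tau)\,d\tau$, and if $F^\epsilon\ge0$ on $[0,T]$ then $\bar S(t)\le\bar S(0)$. 3. (Entropy conservation.) If $\mathcal B=0$ almost everywhere on $\Gamma_b$ and $\Gamma_c$ at all times in $[0,T]$, then $\frac{d\bar S}{dt}+\mathcal D=-F^\epsilon(t)$; at every time at which all $\mathcal P^m=0$, $\frac{d\bar S}{dt}=-F^\epsilon(t)$. 4. (Conservation.) If $\mathcal C=0$ almost everywhere on $\Gamma_b$ and $\Gamma_c$ at all times in $[0,T]$, then $$\frac{d}{dt}\Big\{\int_{\Omega_u}u+\int_{\Omega_v}v-\eta\int_{\Omega_O}u-(1-\eta)\int_{\Omega_O}v\Big\}=-\int_{\Gamma_a}f(u)\cdot\hat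 n_a\,dS-\int_{\Gamma_d}f(v)\cdot\hat n_d\,dS .$$ 5. Let $f^{ec}_i(a,c)$ be a continuous two-point flux on $\mathcal A\times\mathcal A$ with $f_i^{ec}(a,a)=f_i(a)$ that satisfies the Tadmor jump condition $f^\epsilon_i(a)-f^\epsilon_i(c)=w(a)^Tf_i(a)-w(c)^Tf_i(c)-(w(a)-w(c))^Tf^{ec}_i(a,c)$. If $\mathcal P_{i,u}=\beta(f^{ec}_i(u,v)-f_i(u))$ and $\mathcal P_{i,v}=-\beta(f^{ec}_i(u,v)-f_i(v))$ on each interface, then $\mathcal B=0$ (so in particular $\mathcal B\ge0$) and $\mathcal C=0$ almost everywhere on $\Gamma_b$ and $\Gamma_c$ at all times in $[0,T]$, so that 2, 3 and 4 all apply. -/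

import Mathlib

open MeasureTheory Set

noncomputable section

namespace Overset

/-- Physical space `ℝ^d`. -/
abbrev Space (d : ℕ) := EuclideanSpace ℝ (Fin d)

/-- State space `ℝ^p`. -/
abbrev State (p : ℕ) := EuclideanSpace ℝ (Fin p)

/-- Normal component `∑ i, n_i g_i` of a space-vector `g` whose components lie in `V`. -/
def normalComp {d : ℕ} {V : Type*} [AddCommGroup V] [Module ℝ V]
    (n : Space d) (g : Fin d → V) : V :=
  ∑ i, n i • g i

/-! ### The conservation law and its entropy pair -/

/-- A system of `p` conservation laws `∂_t ω + ∑ i, ∂_i (f i ω) = 0` in `d` space dimensions, on an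
open set `adm` of admissible states, with an entropy pair `(s, fε)`: `s` is convex and
`D(fε i)(ω) = w(ω)ᵀ D(f i)(ω)`, where `w = ∂s/∂ω`. -/
structure EntropySystem (d p : ℕ) where
  adm : Set (State p)
  f : Fin d → State p → State p
  s : State p → ℝ
  fε : Fin d → State p → ℝ
  isOpen_adm : IsOpen adm
  contDiffOn_f : ∀ i, ContDiffOn ℝ 1 (f i) adm
  contDiffOn_s : ContDiffOn ℝ 1 s adm
  contDiffOn_fε : ∀ i, ContDiffOn ℝ 1 (fε i) adm
  convexOn_s : ConvexOn ℝ adm s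
  entropy_flux : ∀ ω ∈ adm, ∀ i, ∀ h : State p,
    fderiv ℝ (fε i) ω h = inner ℝ (gradient s ω) (fderiv ℝ (f i) ω h)

/-- The entropy variables `w = ∂s/∂ω`. -/
def EntropySystem.w {d p : ℕ} (L : EntropySystem d p) (ω : State p) : State p :=
  gradient L.s ω

/-- A two-point flux is *entropy conserving* if it is continuous, consistent with `f`, and satisfies
the Tadmor jump condition `⟦fε⟧ = ⟦wᵀ f⟧ - ⟦w⟧ᵀ fec` in each coordinate direction. -/
structure IsEntropyConservingFlux {d p : ℕ} (L : EntropySystem d p)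
    (fec : Fin d → State p → State p → State p) : Prop where
  continuousOn : ∀ i, ContinuousOn (fun z : State p × State p => fec i z.1 z.2) (L.adm ×ˢ L.adm)
  consistent : ∀ i, ∀ a ∈ L.adm, fec i a a = L.f i a
  jump : ∀ i, ∀ a ∈ L.adm, ∀ c ∈ L.adm,
    L.fε i a - L.fε i c =
      (inner ℝ (L.w a) (L.f i a) - inner ℝ (L.w c) (L.f i c)) -
        inner ℝ (L.w a - L.w c) (fec i a c)

/-! ### Geometry -/

/-- Surface measure: the `(d-1)`-dimensional Hausdorff measure, normalized to agree with Lebesgue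
measure on hyperplanes (counting measure when `d = 1`). -/
def surf (d : ℕ) : Measure (Space d) := μHE[d - 1]

/-- `Ω` is a set of finite perimeter with outward unit normal `n` on its boundary: the boundary has
finite surface measure, and `n` is the unit vector field for which the distributional gradient of the
indicator function of `Ω` is `-n` times the surface measure on the boundary, i.e.
`-∫_Ω ∂_i ψ = -∫_∂Ω ψ n_i` for all smooth compactly supported `ψ`. Surface measure being fixed, this
determines `n` up to a null set. -/
structure IsOuterUnitNormal {d : ℕ} (Ω : Set (Space d)) (n : Space d → Space d) : Prop where
  finite_area : surf d (frontier Ω) < ⊤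
  aestronglyMeasurable : AEStronglyMeasurable n ((surf d).restrict (frontier Ω))
  norm_eq_one : ∀ᵐ x ∂((surf d).restrict (frontier Ω)), ‖n x‖ = 1
  grad_indicator : ∀ ψ : Space d → ℝ, ContDiff ℝ (⊤ : ℕ∞) ψ → HasCompactSupport ψ → ∀ i : Fin d,
    -∫ x in Ω, fderiv ℝ ψ x (EuclideanSpace.single i 1) =
      -∫ x in frontier Ω, ψ x * n x i ∂(surf d)

/-- Two overlapping bounded open subdomains (the overset domain `Ωu` and the base domain `Ωv`) with
their outward unit normals; the boundary curves are pairwise disjoint. -/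
structure Geometry (d : ℕ) where
  Ωu : Set (Space d)
  Ωv : Set (Space d)
  nu : Space d → Space d
  nv : Space d → Space d
  isOpen_u : IsOpen Ωu
  isOpen_v : IsOpen Ωv
  bounded_u : Bornology.IsBounded Ωu
  bounded_v : Bornology.IsBounded Ωv
  normal_u : IsOuterUnitNormal Ωu nu
  normal_v : IsOuterUnitNormal Ωv nv
  disjoint_frontier : Disjoint (frontier Ωu) (frontier Ωv)

namespace Geometry

variable {d : ℕ} (G : Geometry d)

/-- The whole domain. -/
def Ω : Set (Space d) := G.Ωu ∪ G.Ωv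
/-- The overlap region. -/
def ΩO : Set (Space d) := G.Ωu ∩ G.Ωv
/-- The physical boundary of the overset domain. -/
def Γa : Set (Space d) := frontier G.Ωu \ G.Ωv
/-- The artificial boundary of the base domain, inside the overset domain. -/
def Γb : Set (Space d) := frontier G.Ωv ∩ G.Ωu
/-- The artificial boundary of the overset domain, inside the base domain. -/
def Γc : Set (Space d) := frontier G.Ωu ∩ G.Ωv
/-- The physical boundary of the base domain. -/
def Γd : Set (Space d) := frontier G.Ωv \ G.Ωu

end Geometry

/-! ### Penalties -/

/-- Interface penalty functions along `Γb` and `Γc` for the two equations, given as space-vectors of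
two-state functions; the penalty at a point of a curve is the component along the normal there.
They vanish when the two states agree. -/
structure InterfacePenalties {d p : ℕ} (L : EntropySystem d p) where
  bu : Fin d → State p → State p → State p
  bv : Fin d → State p → State p → State p
  cu : Fin d → State p → State p → State p
  cv : Fin d → State p → State p → State p
  continuousOn_bu : ∀ i, ContinuousOn (fun z : State p × State p => bu i z.1 z.2) (L.adm ×ˢ L.adm)
  continuousOn_bv : ∀ i, ContinuousOn (fun z : State p × State p => bv i z.1 z.2) (L.adm ×ˢ L.adm)
  continuousOn_cu : ∀ i, ContinuousOn (fun z : State p × State p => cu i z.1 z.2) (L.adm ×ˢ L.adm)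
  continuousOn_cv : ∀ i, ContinuousOn (fun z : State p × State p => cv i z.1 z.2) (L.adm ×ˢ L.adm)
  bu_self : ∀ i, ∀ ω ∈ L.adm, bu i ω ω = 0
  bv_self : ∀ i, ∀ ω ∈ L.adm, bv i ω ω = 0
  cu_self : ∀ i, ∀ ω ∈ L.adm, cu i ω ω = 0
  cv_self : ∀ i, ∀ ω ∈ L.adm, cv i ω ω = 0

/-- The interface penalties are those built from the two-point flux `fec`:
`Pu = β (fec - f(u))`, `Pv = -β (fec - f(v))`, with `β = -η` on `Γb` and `β = 1 - η` on `Γc`. -/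
def InterfacePenalties.IsBuiltFrom {d p : ℕ} {L : EntropySystem d p} (P : InterfacePenalties L)
    (η : ℝ) (fec : Fin d → State p → State p → State p) : Prop :=
  ∀ i, ∀ a ∈ L.adm, ∀ c ∈ L.adm,
    P.bu i a c = (-η) • (fec i a c - L.f i a) ∧
    P.bv i a c = -((-η) • (fec i a c - L.f i c)) ∧
    P.cu i a c = (1 - η) • (fec i a c - L.f i a) ∧
    P.cv i a c = -((1 - η) • (fec i a c - L.f i c))

/-- Interior penalty data: points of the overlap region and matrices (possibly varying in time). -/
structure InteriorPenalties {d : ℕ} (p : ℕ) (G : Geometry d) where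
  M : ℕ
  pt : Fin M → Space d
  pt_mem : ∀ m, pt m ∈ G.ΩO
  Su : Fin M → ℝ → Matrix (Fin p) (Fin p) ℝ
  Sv : Fin M → ℝ → Matrix (Fin p) (Fin p) ℝ

/-- Matrix times state vector. -/
def act {p : ℕ} (A : Matrix (Fin p) (Fin p) ℝ) (z : State p) : State p :=
  Matrix.toEuclideanLin A z

/-- Positive definiteness `yᵀ A y > 0` for `y ≠ 0`; symmetry is not required. -/
def IsPosDef {p : ℕ} (A : Matrix (Fin p) (Fin p) ℝ) : Prop :=
  ∀ y : State p, y ≠ 0 → 0 < inner ℝ y (act A y)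

/-! ### The overset domain problem -/

/-- The residual `∂_t u + ∑ i, ∂_i (f i u)` at `(t, x)`. -/
def residual {d p : ℕ} (L : EntropySystem d p) (u : ℝ → Space d → State p)
    (t : ℝ) (x : Space d) : State p :=
  deriv (fun τ => u τ x) t +
    ∑ i, fderiv ℝ (fun y => L.f i (u t y)) x (EuclideanSpace.single i 1)

/-- `u` is continuously differentiable up to the boundary on `[0,T] × closure Ω` (that is, on a
neighbourhood of that set), with admissible values there. -/
def IsRegular {d p : ℕ} (L : EntropySystem d p) (T : ℝ) (Ω : Set (Space d))
    (u : ℝ → Space d → State p) : Prop :=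
  ∀ t ∈ Icc 0 T, ∀ x ∈ closure Ω,
    ContDiffAt ℝ 1 (fun z : ℝ × Space d => u z.1 z.2) (t, x) ∧ u t x ∈ L.adm

/-- `𝒯` is a space of (time dependent) test functions on `Ω` containing the constant states. -/
structure IsTestSpace {d p : ℕ} (T : ℝ) (Ω : Set (Space d))
    (𝒯 : Submodule ℝ (ℝ → Space d → State p)) : Prop where
  continuousOn : ∀ φ ∈ 𝒯, ∀ t ∈ Icc 0 T, ContinuousOn (φ t) (closure Ω)
  const_mem : ∀ c : State p, (fun _ _ => c) ∈ 𝒯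

section Problem

variable {d p : ℕ} (L : EntropySystem d p) (G : Geometry d) (P : InterfacePenalties L)
  (Q : InteriorPenalties p G) (u v : ℝ → Space d → State p)

/-- The interior penalty terms of equation (O), tested with `φ`. -/
def interiorU (φ : Space d → State p) (t : ℝ) : ℝ :=
  (1 / (Q.M : ℝ)) * ∑ m, inner ℝ (φ (Q.pt m))
    (act (Q.Su m t) (L.w (u t (Q.pt m)) - L.w (v t (Q.pt m))))

/-- The interior penalty terms of equation (B), tested with `φ`. -/
def interiorV (φ : Space d → State p) (t : ℝ) : ℝ :=
  (1 / (Q.M : ℝ)) * ∑ m, inner ℝ (φ (Q.pt m))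
    (act (Q.Sv m t) (L.w (v t (Q.pt m)) - L.w (u t (Q.pt m))))

/-- `(u, v)` solves the overset domain problem with interface and interior penalties on `[0,T]`, in
weak form with respect to the test spaces `𝒯u`, `𝒯v`. The equations hold on `Ωu` and on `Ωv`, and
in the overlap region, on which the interior penalties act but the interface penalties, being lifted
from the curves `Γb` and `Γc` bounding it, are not applied. -/
structure IsWeakSolution (T : ℝ) (𝒯u 𝒯v : Submodule ℝ (ℝ → Space d → State p)) : Prop where
  regular_u : IsRegular L T G.Ωu u
  regular_v : IsRegular L T G.Ωv v
  eq_u : ∀ φ ∈ 𝒯u, ∀ t ∈ Icc 0 T,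
    (∫ x in G.Ωu, inner ℝ (φ t x) (residual L u t x)) +
    (∫ x in G.Γb, inner ℝ (φ t x)
      (normalComp (G.nv x) fun i => P.bu i (u t x) (v t x)) ∂(surf d)) +
    (∫ x in G.Γc, inner ℝ (φ t x)
      (normalComp (G.nu x) fun i => P.cu i (u t x) (v t x)) ∂(surf d)) +
    interiorU L G Q u v (φ t) t = 0
  eq_v : ∀ φ ∈ 𝒯v, ∀ t ∈ Icc 0 T,
    (∫ x in G.Ωv, inner ℝ (φ t x) (residual L v t x)) +
    (∫ x in G.Γb, inner ℝ (φ t x)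
      (normalComp (G.nv x) fun i => P.bv i (u t x) (v t x)) ∂(surf d)) +
    (∫ x in G.Γc, inner ℝ (φ t x)
      (normalComp (G.nu x) fun i => P.cv i (u t x) (v t x)) ∂(surf d)) +
    interiorV L G Q u v (φ t) t = 0
  eq_u_overlap : ∀ φ ∈ 𝒯u, ∀ t ∈ Icc 0 T,
    (∫ x in G.ΩO, inner ℝ (φ t x) (residual L u t x)) + interiorU L G Q u v (φ t) t = 0
  eq_v_overlap : ∀ φ ∈ 𝒯v, ∀ t ∈ Icc 0 T,
    (∫ x in G.ΩO, inner ℝ (φ t x) (residual L v t x)) + interiorV L G Q u v (φ t) t = 0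

/-! ### Total entropy, conserved quantity, dissipation -/

open Classical in
/-- The entropy density of the overset problem on `Ω`, with weight `η` in the overlap. -/
def overlapEntropy (η : ℝ) (t : ℝ) (x : Space d) : ℝ :=
  if x ∈ G.ΩO then (1 - η) * L.s (u t x) + η * L.s (v t x)
  else if x ∈ G.Ωu then L.s (u t x)
  else L.s (v t x)

/-- The total entropy. -/
def totalEntropy (η : ℝ) (t : ℝ) : ℝ :=
  ∫ x in G.Ω, overlapEntropy L G u v η t x

/-- The total amount of the state, the overlap being counted once:
`∫_Ωu u + ∫_Ωv v - {η ∫_ΩO u + (1-η) ∫_ΩO v}`. -/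
def totalState (η : ℝ) (t : ℝ) : State p :=
  (∫ x in G.Ωu, u t x) + (∫ x in G.Ωv, v t x) -
    (η • (∫ x in G.ΩO, u t x) + (1 - η) • (∫ x in G.ΩO, v t x))

/-- The entropy flux out of the physical boundary. -/
def boundaryEntropyFlux (t : ℝ) : ℝ :=
  (∫ x in G.Γa, normalComp (G.nu x) (fun i => L.fε i (u t x)) ∂(surf d)) +
    ∫ x in G.Γd, normalComp (G.nv x) (fun i => L.fε i (v t x)) ∂(surf d)

/-- The flux of the state out of the physical boundary. -/
def boundaryFlux (t : ℝ) : State p :=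
  (∫ x in G.Γa, normalComp (G.nu x) (fun i => L.f i (u t x)) ∂(surf d)) +
    ∫ x in G.Γd, normalComp (G.nv x) (fun i => L.f i (v t x)) ∂(surf d)

/-- The dissipation term at the `m`-th point:
`(1-η) w_uᵀ Σ_u (w_u - w_v) + η w_vᵀ Σ_v (w_v - w_u)`. -/
def pointDissipation (η : ℝ) (t : ℝ) (m : Fin Q.M) : ℝ :=
  (1 - η) * inner ℝ (L.w (u t (Q.pt m)))
      (act (Q.Su m t) (L.w (u t (Q.pt m)) - L.w (v t (Q.pt m)))) +
    η * inner ℝ (L.w (v t (Q.pt m)))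
      (act (Q.Sv m t) (L.w (v t (Q.pt m)) - L.w (u t (Q.pt m))))

/-- The total dissipation, the average of the point dissipations. -/
def dissipation (η : ℝ) (t : ℝ) : ℝ :=
  (1 / (Q.M : ℝ)) * ∑ m, pointDissipation L G Q u v η t m

/-! ### Interface conditions -/

/-- The interface entropy term `(fε(a) - fε(c))·β n + w_aᵀ Pu + w_cᵀ Pv`. -/
def interfaceEntropy (β : ℝ) (n : Space d) (Pu Pv : Fin d → State p → State p → State p)
    (a c : State p) : ℝ :=
  normalComp (β • n) (fun i => L.fε i a - L.fε i c) +
    inner ℝ (L.w a) (normalComp n fun i => Pu i a c) +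
    inner ℝ (L.w c) (normalComp n fun i => Pv i a c)

/-- The interface conservation term `(f(a) - f(c))·β n + Pu + Pv`. -/
def interfaceFlux (β : ℝ) (n : Space d) (Pu Pv : Fin d → State p → State p → State p)
    (a c : State p) : State p :=
  normalComp (β • n) (fun i => L.f i a - L.f i c) +
    (normalComp n fun i => Pu i a c) + (normalComp n fun i => Pv i a c)

/-- The entropy boundedness condition on the two interface curves, along `(u, v)`. -/
def InterfaceEntropyBounded (T η : ℝ) : Prop :=
  ∀ t ∈ Icc 0 T,
    (∀ᵐ x ∂((surf d).restrict G.Γb),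
      0 ≤ interfaceEntropy L (-η) (G.nv x) P.bu P.bv (u t x) (v t x)) ∧
    (∀ᵐ x ∂((surf d).restrict G.Γc),
      0 ≤ interfaceEntropy L (1 - η) (G.nu x) P.cu P.cv (u t x) (v t x))

/-- The entropy preservation condition on the two interface curves, along `(u, v)`. -/
def InterfaceEntropyConserving (T η : ℝ) : Prop :=
  ∀ t ∈ Icc 0 T,
    (∀ᵐ x ∂((surf d).restrict G.Γb),
      interfaceEntropy L (-η) (G.nv x) P.bu P.bv (u t x) (v t x) = 0) ∧
    (∀ᵐ x ∂((surf d).restrict G.Γc),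
      interfaceEntropy L (1 - η) (G.nu x) P.cu P.cv (u t x) (v t x) = 0)

/-- The conservation condition on the two interface curves, along `(u, v)`. -/
def InterfaceConservative (T η : ℝ) : Prop :=
  ∀ t ∈ Icc 0 T,
    (∀ᵐ x ∂((surf d).restrict G.Γb),
      interfaceFlux L (-η) (G.nv x) P.bu P.bv (u t x) (v t x) = 0) ∧
    (∀ᵐ x ∂((surf d).restrict G.Γc),
      interfaceFlux L (1 - η) (G.nu x) P.cu P.cv (u t x) (v t x) = 0)

end Problem

end Overset

end

open Overset

namespace Overset

open Filter Topology Metric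
open scoped ContDiff Manifold Convolution

/-! ### Smooth cutoffs and mollification -/

/-! Entropy balance and conservation are one computation with two multipliers. A companion law
(`IsCompanionLaw`) consists of a density `σ`, fluxes `Φ i` and a multiplier `ψ` such that `ψ` times
the residual is `∂_t σ + ∑ ∂_i Φ i`. The choice `ψ = w` gives the entropy pair; a constant `ψ = c`
gives the `c`-component of the system. Both are admissible test functions.

Test all four weak equations with `ψ(u)`, `ψ(v)` and form (equation on `Ωu`) + (equation on `Ωv`) -
`η` (overlap equation for `u`) - `(1-η)` (overlap equation for `v`). The time derivatives add up to
that of `totalDensity`, which counts the overlap once. The divergence theorem leaves the physical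
fluxes on `Γa` and `Γd`. On the interfaces the flux jump `Φ(u) - Φ(v)` survives with factor `-η` on
`Γb` and `1-η` on `Γc`, which is exactly `β`, and joins the interface penalties to form
`interfaceTerm`. The interior penalties keep the weights `1-η` and `η`. This identity is
`IsWeakSolution.hasDerivAt_totalDensity`.

The coupling of the matrices turns the interior terms into a nonnegative quadratic form in `w_u -
w_v` when `ψ = w`, and into zero when `ψ` is constant. The sign or vanishing of the interface terms
then gives the rates, and a comparison argument integrates the entropy bound in time.

The analytic work lies in the divergence theorem, since the normal is specified only through smooth
compactly supported test functions. Cutoffs and mollification extend it to functions that are `C¹`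
up to the boundary (`IsOuterUnitNormal.integral_fderiv`). On the overlap
(`Geometry.integral_fderiv_ΩO`) a cutoff separating the two disjoint boundaries treats one interface
at a time. -/

theorem contDiffAt_continuousAt_fderiv_apply {E F : Type*} [NormedAddCommGroup E] [NormedSpace ℝ E]
    [NormedAddCommGroup F] [NormedSpace ℝ F] {g : E → F} {x : E} (hg : ContDiffAt ℝ 1 g x) (e : E) :
    ContinuousAt (fun y => fderiv ℝ g y e) x :=
  ((hg.fderiv_right (m := 0) (by norm_num)).continuousAt).clm_apply continuousAt_const

/-- Prescribing germs rather than values makes the derivatives of products with the cutoff known as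
well, and lets such products be extended by zero. -/
theorem exists_contDiff_zero_one_nhds {E : Type*} [NormedAddCommGroup E] [NormedSpace ℝ E]
    [FiniteDimensional ℝ E] {s t : Set E} (hs : IsClosed s) (ht : IsClosed t) (hd : Disjoint s t) :
    ∃ χ : E → ℝ, ContDiff ℝ ∞ χ ∧ (∀ x ∈ s, χ =ᶠ[𝓝 x] 0) ∧ (∀ x ∈ t, χ =ᶠ[𝓝 x] 1) := by
  obtain ⟨f, h0, h1, -⟩ := exists_contMDiffMap_zero_one_nhds_of_isClosed 𝓘(ℝ, E) hs ht hd (n := (⊤ : ℕ∞))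
  refine ⟨f, f.contMDiff.contDiff, fun x hx => ?_, fun x hx => ?_⟩
  · exact Filter.Eventually.filter_mono (nhds_le_nhdsSet hx) h0
  · exact Filter.Eventually.filter_mono (nhds_le_nhdsSet hx) h1

/-- A function that is `C¹` near a compact set agrees near that set with a compactly supported
`C¹` function. -/
theorem exists_contDiff_hasCompactSupport_eventuallyEq {E : Type*} [NormedAddCommGroup E]
    [NormedSpace ℝ E] [FiniteDimensional ℝ E] {K : Set E} (hK : IsCompact K) {g : E → ℝ}
    (hg : ∀ x ∈ K, ContDiffAt ℝ 1 g x) :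
    ∃ h : E → ℝ, ContDiff ℝ 1 h ∧ HasCompactSupport h ∧ ∀ x ∈ K, h =ᶠ[𝓝 x] g := by
  have hUo : IsOpen {x | ContDiffAt ℝ 1 g x} :=
    isOpen_iff_mem_nhds.2 fun x hx => ContDiffAt.eventually hx (by simp)
  obtain ⟨V, hVo, hKV, hVU, hVc⟩ := exists_open_between_and_isCompact_closure hK hUo hg
  obtain ⟨χ, hχ, h0, h1⟩ := exists_contDiff_zero_one_nhds hVo.isClosed_compl hK.isClosed
    (disjoint_left.2 fun x hx hxK => hx (hKV hxK))
  refine ⟨fun x => χ x * g x, ?_, ?_, fun x hx => ?_⟩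
  · refine contDiff_iff_contDiffAt.2 fun x => ?_
    by_cases hx : x ∈ V
    · exact (hχ.contDiffAt.of_le (by simp)).mul (hVU (subset_closure hx))
    · have : (fun x => χ x * g x) =ᶠ[𝓝 x] fun _ => 0 := by
        filter_upwards [h0 x hx] with y hy
        simp [hy]
      exact contDiffAt_const.congr_of_eventuallyEq this
  · refine HasCompactSupport.intro hVc fun x hx => ?_
    have := (h0 x fun h => hx (subset_closure h)).self_of_nhds
    simp [this]
  · filter_upwards [h1 x hx] with y hy
    simp [hy]

/-- Compactly supported `C¹` functions are uniform `C¹` limits of compactly supported smooth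
functions. -/
theorem exists_contDiff_infty_fderiv_approx {d : ℕ} {g : Space d → ℝ} (hg : ContDiff ℝ 1 g)
    (hc : HasCompactSupport g) {ε : ℝ} (hε : 0 < ε) :
    ∃ h : Space d → ℝ, ContDiff ℝ ∞ h ∧ HasCompactSupport h ∧ (∀ x, dist (h x) (g x) ≤ ε) ∧
      ∀ x, dist (fderiv ℝ h x) (fderiv ℝ g x) ≤ ε := by
  have hg' : Continuous (fderiv ℝ g) := hg.continuous_fderiv one_ne_zero
  obtain ⟨δ₁, hδ₁, h₁⟩ := Metric.uniformContinuous_iff.1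
    (hc.uniformContinuous_of_continuous hg.continuous) ε hε
  obtain ⟨δ₂, hδ₂, h₂⟩ := Metric.uniformContinuous_iff.1
    ((hc.fderiv ℝ).uniformContinuous_of_continuous hg') ε hε
  set δ := min δ₁ δ₂
  have hδ : 0 < δ := lt_min hδ₁ hδ₂
  set φ : ContDiffBump (0 : Space d) := ⟨δ / 2, δ, half_pos hδ, half_lt_self hδ⟩
  have hφi : LocallyIntegrable (φ.normed volume) (volume : Measure (Space d)) :=
    φ.continuous_normed.locallyIntegrable
  refine ⟨φ.normed volume ⋆[ContinuousLinearMap.lsmul ℝ ℝ, volume] g, ?_, ?_, fun x => ?_,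
    fun x => ?_⟩
  · exact φ.hasCompactSupport_normed.contDiff_convolution_left _ φ.contDiff_normed
      hg.continuous.locallyIntegrable
  · exact φ.hasCompactSupport_normed.convolution _ hc
  · exact φ.dist_normed_convolution_le hg.continuous.aestronglyMeasurable fun y hy =>
      (h₁ (lt_of_lt_of_le hy (min_le_left _ _))).le
  -- Since `g` is `C¹`, the derivative can be moved onto `g`: the derivative of the mollification is
  -- the mollification of `fderiv ℝ g`, controlled by the modulus of continuity of the latter.
  · rw [(hc.hasFDerivAt_convolution_right (ContinuousLinearMap.lsmul ℝ ℝ) hφi hg x).fderiv]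
    have : (φ.normed volume ⋆[(ContinuousLinearMap.lsmul ℝ ℝ).precompR (Space d), volume]
        fderiv ℝ g) x = (φ.normed volume ⋆[ContinuousLinearMap.lsmul ℝ ℝ, volume] fderiv ℝ g) x := by
      simp only [convolution_def]
      congr 1
    rw [this]
    exact φ.dist_normed_convolution_le hg'.aestronglyMeasurable fun y hy =>
      (h₂ (lt_of_lt_of_le hy (min_le_right _ _))).le

/-! ### The divergence theorem -/

theorem IsOuterUnitNormal.isFiniteMeasure {d : ℕ} {Ω : Set (Space d)} {n : Space d → Space d}
    (hn : IsOuterUnitNormal Ω n) : IsFiniteMeasure ((surf d).restrict (frontier Ω)) :=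
  ⟨by simpa using hn.finite_area⟩

theorem isCompact_frontier_of_isBounded {d : ℕ} {Ω : Set (Space d)} (hb : Bornology.IsBounded Ω) :
    IsCompact (frontier Ω) :=
  hb.isCompact_closure.of_isClosed_subset isClosed_frontier frontier_subset_closure

theorem IsOuterUnitNormal.aestronglyMeasurable_apply {d : ℕ} {Ω : Set (Space d)}
    {n : Space d → Space d} (hn : IsOuterUnitNormal Ω n) (i : Fin d) :
    AEStronglyMeasurable (fun x => n x i) ((surf d).restrict (frontier Ω)) :=
  (EuclideanSpace.proj (𝕜 := ℝ) i).continuous.comp_aestronglyMeasurable hn.aestronglyMeasurable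

theorem IsOuterUnitNormal.norm_apply_le {d : ℕ} {Ω : Set (Space d)} {n : Space d → Space d}
    (hn : IsOuterUnitNormal Ω n) (i : Fin d) :
    ∀ᵐ x ∂((surf d).restrict (frontier Ω)), ‖n x i‖ ≤ 1 := by
  filter_upwards [hn.norm_eq_one] with x hx
  exact hx ▸ PiLp.norm_apply_le (n x) i

/-- Continuous functions times a component of the normal are integrable on compact pieces of the
boundary. -/
theorem IsOuterUnitNormal.integrableOn_smul {d : ℕ} {Ω : Set (Space d)} {n : Space d → Space d}
    (hn : IsOuterUnitNormal Ω n) {V : Type*} [NormedAddCommGroup V] [NormedSpace ℝ V]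
    {Γ : Set (Space d)} (hΓ : Γ ⊆ frontier Ω) (hc : IsCompact Γ) {g : Space d → V}
    (hg : ContinuousOn g Γ) (i : Fin d) :
    IntegrableOn (fun x => n x i • g x) Γ (surf d) := by
  have := hn.isFiniteMeasure
  have hle : (surf d).restrict Γ ≤ (surf d).restrict (frontier Ω) := Measure.restrict_mono hΓ le_rfl
  have : IsFiniteMeasure ((surf d).restrict Γ) := isFiniteMeasure_of_le _ hle
  obtain ⟨C, hC⟩ := hc.exists_bound_of_continuousOn hg
  refine Integrable.of_bound (C := C) ?_ ?_
  · exact ((hn.aestronglyMeasurable_apply i).mono_measure hle).smul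
      (hg.aestronglyMeasurable_of_isCompact hc hc.measurableSet)
  · filter_upwards [ae_mono hle (hn.norm_apply_le i), ae_restrict_mem hc.measurableSet] with x h1 h2
    rw [norm_smul]
    calc ‖n x i‖ * ‖g x‖ ≤ 1 * C := mul_le_mul h1 (hC x h2) (norm_nonneg _) zero_le_one
      _ = C := one_mul C

theorem integrableOn_fderiv_apply {d : ℕ} {Ω : Set (Space d)} (hb : Bornology.IsBounded Ω)
    {g : Space d → ℝ} (hg : ∀ x ∈ closure Ω, ContDiffAt ℝ 1 g x) (e : Space d) :
    IntegrableOn (fun x => fderiv ℝ g x e) Ω := by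
  have h : ContinuousOn (fun x => fderiv ℝ g x e) (closure Ω) := fun x hx =>
    (contDiffAt_continuousAt_fderiv_apply (hg x hx) e).continuousWithinAt
  exact (h.integrableOn_compact hb.isCompact_closure).mono_set subset_closure

/-- Both sides are continuous under uniform `C¹` convergence, because `Ω` has finite volume and its
boundary finite area. The identity therefore passes from smooth functions to their `C¹` limits. -/
theorem IsOuterUnitNormal.integral_fderiv_of_hasCompactSupport {d : ℕ} {Ω : Set (Space d)}
    {n : Space d → Space d} (hn : IsOuterUnitNormal Ω n) (hb : Bornology.IsBounded Ω)
    {g : Space d → ℝ} (hg : ContDiff ℝ 1 g) (hc : HasCompactSupport g) (i : Fin d) :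
    ∫ x in Ω, fderiv ℝ g x (EuclideanSpace.single i 1) =
      ∫ x in frontier Ω, n x i • g x ∂(surf d) := by
  have hfin := hn.isFiniteMeasure
  have hΩfin : IsFiniteMeasure ((volume : Measure (Space d)).restrict Ω) :=
    ⟨by simpa using hb.measure_lt_top⟩
  set a := (volume : Measure (Space d)).real Ω
  set b := (surf d).real (frontier Ω)
  have key : ∀ ε > 0, dist (∫ x in Ω, fderiv ℝ g x (EuclideanSpace.single i 1))
      (∫ x in frontier Ω, n x i • g x ∂(surf d)) ≤ ε * (a + b) := by
    intro ε hε
    obtain ⟨h, hh, hhc, h0, h1⟩ := exists_contDiff_infty_fderiv_approx hg hc hε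
    have hh1 : ContDiff ℝ 1 h := hh.of_le (by simp)
    have e := neg_injective (hn.grad_indicator h hh hhc i)
    have e' : ∫ x in Ω, fderiv ℝ h x (EuclideanSpace.single i 1) =
        ∫ x in frontier Ω, n x i • h x ∂(surf d) := by
      rw [e]; simp only [smul_eq_mul, mul_comm]
    have A : ‖∫ x in Ω, (fderiv ℝ h x (EuclideanSpace.single i 1) -
        fderiv ℝ g x (EuclideanSpace.single i 1))‖ ≤ ε * a := by
      refine norm_setIntegral_le_of_norm_le_const hb.measure_lt_top fun x _ => ?_
      rw [← sub_apply]
      refine (ContinuousLinearMap.le_opNorm _ _).trans ?_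
      simpa [dist_eq_norm] using h1 x
    have B : ‖∫ x in frontier Ω, (n x i • h x - n x i • g x) ∂(surf d)‖ ≤ ε * b := by
      have := norm_integral_le_of_norm_le_const (μ := (surf d).restrict (frontier Ω)) (C := ε)
        (f := fun x => n x i • h x - n x i • g x) (by
          filter_upwards [hn.norm_apply_le i] with x hx
          rw [← smul_sub, norm_smul]
          calc _ ≤ 1 * ε := mul_le_mul hx (by simpa [dist_eq_norm] using h0 x) (norm_nonneg _)
                zero_le_one
            _ = ε := one_mul ε)
      simpa [b, Measure.real] using this
    have hK := isCompact_frontier_of_isBounded hb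
    rw [integral_sub (integrableOn_fderiv_apply hb (fun x _ => hh1.contDiffAt) _)
      (integrableOn_fderiv_apply hb (fun x _ => hg.contDiffAt) _), ← dist_eq_norm] at A
    rw [integral_sub (hn.integrableOn_smul subset_rfl hK hh.continuous.continuousOn i)
      (hn.integrableOn_smul subset_rfl hK hg.continuous.continuousOn i), ← dist_eq_norm, ← e'] at B
    calc _ ≤ _ := dist_triangle_left _ _ _
      _ ≤ ε * a + ε * b := add_le_add A B
      _ = _ := by ring
  have hab : 0 ≤ a + b := by positivity
  refine eq_of_forall_dist_le fun ε hε => ?_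
  -- The `+ 1` keeps the denominator positive when `a + b = 0`.
  refine (key (ε / (a + b + 1)) (by positivity)).trans ?_
  rw [div_mul_eq_mul_div, div_le_iff₀ (by positivity)]
  nlinarith

/-- The divergence theorem for functions that are `C¹` up to the boundary. -/
theorem IsOuterUnitNormal.integral_fderiv {d : ℕ} {Ω : Set (Space d)} {n : Space d → Space d}
    (hn : IsOuterUnitNormal Ω n) (ho : IsOpen Ω) (hb : Bornology.IsBounded Ω) {g : Space d → ℝ}
    (hg : ∀ x ∈ closure Ω, ContDiffAt ℝ 1 g x) (i : Fin d) :
    ∫ x in Ω, fderiv ℝ g x (EuclideanSpace.single i 1) =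
      ∫ x in frontier Ω, n x i • g x ∂(surf d) := by
  obtain ⟨h, hh, hc, heq⟩ :=
    exists_contDiff_hasCompactSupport_eventuallyEq hb.isCompact_closure hg
  have := hn.integral_fderiv_of_hasCompactSupport hb hh hc i
  rw [setIntegral_congr_fun (g := fun x => fderiv ℝ g x (EuclideanSpace.single i 1))
    ho.measurableSet fun x hx => by simp only [(heq x (subset_closure hx)).fderiv_eq],
    setIntegral_congr_fun (g := fun x => n x i • g x) isClosed_frontier.measurableSet fun x hx => by
      simp only [(heq x (frontier_subset_closure hx)).self_of_nhds]] at this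
  exact this

/-- As `g` vanishes near `frontier W`, its extension by zero outside `W` is still `C¹` up to the
boundary of `Ω`. The divergence theorem on `Ω` applies to the extension, and only the parts inside
`W` contribute. -/
theorem IsOuterUnitNormal.integral_fderiv_inter_of_vanish {d : ℕ} {Ω W : Set (Space d)}
    {n : Space d → Space d} (hn : IsOuterUnitNormal Ω n) (ho : IsOpen Ω)
    (hb : Bornology.IsBounded Ω) (hW : IsOpen W) {g : Space d → ℝ}
    (hg : ∀ x ∈ closure (Ω ∩ W), ContDiffAt ℝ 1 g x) (h0 : ∀ x ∈ frontier W, g =ᶠ[𝓝 x] 0)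
    (i : Fin d) :
    ∫ x in Ω ∩ W, fderiv ℝ g x (EuclideanSpace.single i 1) =
      ∫ x in frontier Ω ∩ W, n x i • g x ∂(surf d) := by
  set k : Space d → ℝ := W.indicator g
  have kin : ∀ x ∈ W, k =ᶠ[𝓝 x] g := fun x hx => by
    filter_upwards [hW.mem_nhds hx] with y hy using indicator_of_mem hy g
  have kout : ∀ x ∉ W, k =ᶠ[𝓝 x] fun _ => 0 := fun x hx => by
    by_cases hxc : x ∈ closure W
    · filter_upwards [h0 x (by rw [hW.frontier_eq]; exact ⟨hxc, hx⟩)] with y hy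
      by_cases hyW : y ∈ W
      · simpa [k, hyW] using hy
      · simp [k, hyW]
    · filter_upwards [isClosed_closure.isOpen_compl.mem_nhds hxc] with y hy
      exact indicator_of_notMem (fun h => hy (subset_closure h)) g
  have hk : ∀ x ∈ closure Ω, ContDiffAt ℝ 1 k x := fun x hx => by
    by_cases hxW : x ∈ W
    · exact (hg x (inter_comm Ω W ▸ hW.inter_closure ⟨hxW, hx⟩)).congr_of_eventuallyEq (kin x hxW)
    · exact contDiffAt_const.congr_of_eventuallyEq (kout x hxW)
  have key := hn.integral_fderiv ho hb hk i
  rw [setIntegral_eq_of_subset_of_forall_sdiff_eq_zero (s := Ω ∩ W) ho.measurableSet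
      inter_subset_left (fun x hx => by
        rw [(kout x fun h => hx.2 ⟨hx.1, h⟩).fderiv_eq]; simp),
    setIntegral_eq_of_subset_of_forall_sdiff_eq_zero (s := frontier Ω ∩ W)
      isClosed_frontier.measurableSet inter_subset_left (fun x hx => by
        rw [(kout x fun h => hx.2 ⟨hx.1, h⟩).self_of_nhds]; simp),
    setIntegral_congr_fun (g := fun x => fderiv ℝ g x (EuclideanSpace.single i 1))
      (ho.inter hW).measurableSet fun x hx => by simp only [(kin x hx.2).fderiv_eq],
    setIntegral_congr_fun (g := fun x => n x i • g x)
      (isClosed_frontier.measurableSet.inter hW.measurableSet) fun x hx => by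
      simp only [(kin x hx.2).self_of_nhds]] at key
  exact key

/-! ### The divergence theorem on the overlap -/

namespace Geometry

variable {d : ℕ} (G : Geometry d)

theorem isOpen_ΩO : IsOpen G.ΩO := G.isOpen_u.inter G.isOpen_v

theorem bounded_ΩO : Bornology.IsBounded G.ΩO := G.bounded_u.subset inter_subset_left

/-- The divergence theorem on the overlap region, whose boundary consists of the interfaces. -/
theorem integral_fderiv_ΩO {g : Space d → ℝ} (hg : ∀ x ∈ closure G.ΩO, ContDiffAt ℝ 1 g x)
    (i : Fin d) :
    ∫ x in G.ΩO, fderiv ℝ g x (EuclideanSpace.single i 1) =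
      (∫ x in G.Γc, G.nu x i • g x ∂(surf d)) + ∫ x in G.Γb, G.nv x i • g x ∂(surf d) := by
  -- `χ` is 0 near `∂Ωv` and 1 near `∂Ωu`. Thus `χ g` sees only `Γc`, where it equals `g`, and `(1 -
  -- χ) g` sees only `Γb`, where it equals `g`.
  obtain ⟨χ, hχ, h0, h1⟩ := exists_contDiff_zero_one_nhds (isClosed_frontier (s := G.Ωv))
    (isClosed_frontier (s := G.Ωu)) G.disjoint_frontier.symm
  have hχ1 : ∀ x, ContDiffAt ℝ 1 χ x := fun x => hχ.contDiffAt.of_le (by simp)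
  set g₁ : Space d → ℝ := fun x => χ x * g x
  set g₂ : Space d → ℝ := fun x => (1 - χ x) * g x
  have hg₁ : ∀ x ∈ closure G.ΩO, ContDiffAt ℝ 1 g₁ x := fun x hx => (hχ1 x).mul (hg x hx)
  have hg₂ : ∀ x ∈ closure G.ΩO, ContDiffAt ℝ 1 g₂ x := fun x hx =>
    (contDiffAt_const.sub (hχ1 x)).mul (hg x hx)
  have e₁ := G.normal_u.integral_fderiv_inter_of_vanish G.isOpen_u G.bounded_u G.isOpen_v
    (g := g₁) hg₁ (fun x hx => by filter_upwards [h0 x hx] with y hy; simp [g₁, hy]) i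
  have e₂ := G.normal_v.integral_fderiv_inter_of_vanish G.isOpen_v G.bounded_v G.isOpen_u
    (g := g₂) (by rwa [inter_comm]) (fun x hx => by
      filter_upwards [h1 x hx] with y hy; simp [g₂, hy]) i
  rw [inter_comm G.Ωv] at e₂
  rw [setIntegral_congr_fun (g := fun x => G.nu x i • g x)
    (isClosed_frontier.measurableSet.inter G.isOpen_v.measurableSet) fun x hx => by
      simp [g₁, (h1 x hx.1).self_of_nhds]] at e₁
  rw [setIntegral_congr_fun (g := fun x => G.nv x i • g x)
    (isClosed_frontier.measurableSet.inter G.isOpen_u.measurableSet) fun x hx => by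
      simp [g₂, (h0 x hx.1).self_of_nhds]] at e₂
  rw [Γc, Γb, ← e₁, ← e₂, ← ΩO, ← integral_add (integrableOn_fderiv_apply G.bounded_ΩO hg₁ _)
    (integrableOn_fderiv_apply G.bounded_ΩO hg₂ _)]
  refine setIntegral_congr_fun G.isOpen_ΩO.measurableSet fun x hx => ?_
  have hx' := subset_closure hx
  have hsum : g = g₁ + g₂ := by ext y; simp [g₁, g₂]; ring
  have := congrArg (fun A => A (EuclideanSpace.single i 1)) (fderiv_add
    ((hg₁ x hx').differentiableAt one_ne_zero) ((hg₂ x hx').differentiableAt one_ne_zero))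
  rw [← hsum] at this
  exact this

end Geometry

end Overset

namespace Overset

open Filter Topology Metric

/-! ### Differentiation under the integral sign -/

theorem ContDiffAt.hasDerivAt_slice {d : ℕ} {E : Type*} [NormedAddCommGroup E] [NormedSpace ℝ E]
    {F : ℝ → Space d → E} {t : ℝ} {x : Space d}
    (h : ContDiffAt ℝ 1 (fun z : ℝ × Space d => F z.1 z.2) (t, x)) :
    HasDerivAt (fun τ => F τ x) (fderiv ℝ (fun z : ℝ × Space d => F z.1 z.2) (t, x) (1, 0)) t :=
  (h.differentiableAt one_ne_zero).hasFDerivAt.comp_hasDerivAt (f := fun τ => (τ, x)) t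
    ((hasDerivAt_id t).prodMk (hasDerivAt_const t x))

/-- Regularity at the single time `t₀` spreads to nearby times because being `C¹` at a point is an
open condition and `K` is compact. The derivative is therefore two-sided even at the ends of
`[0,T]`. -/
theorem hasDerivAt_setIntegral_of_contDiffAt {d : ℕ} {E : Type*} [NormedAddCommGroup E]
    [NormedSpace ℝ E] [CompleteSpace E] {A K : Set (Space d)} (hA : MeasurableSet A) (hK : IsCompact K)
    (hAK : A ⊆ K) {F : ℝ → Space d → E} {t₀ : ℝ}
    (hF : ∀ x ∈ K, ContDiffAt ℝ 1 (fun z : ℝ × Space d => F z.1 z.2) (t₀, x)) :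
    (∀ᶠ t in 𝓝 t₀, IntegrableOn (F t) A) ∧
    IntegrableOn (fun x => deriv (fun τ => F τ x) t₀) A ∧
    HasDerivAt (fun t => ∫ x in A, F t x) (∫ x in A, deriv (fun τ => F τ x) t₀) t₀ := by
  set F' : ℝ × Space d → E := fun z => fderiv ℝ (fun z : ℝ × Space d => F z.1 z.2) z (1, 0)
  have hUo : IsOpen {z : ℝ × Space d | ContDiffAt ℝ 1 (fun z : ℝ × Space d => F z.1 z.2) z} :=
    isOpen_iff_mem_nhds.2 fun z hz => ContDiffAt.eventually hz (by simp)
  -- The tube lemma supplies one time interval valid for all `x ∈ K`; on a compact subinterval times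
  -- `K` the time derivative is bounded, which gives the dominating constant.
  obtain ⟨I, V, hI, -, htI, hKV, hIV⟩ := generalized_tube_lemma (isCompact_singleton (x := t₀)) hK
    hUo (by rintro ⟨t, x⟩ ⟨ht, hx⟩; obtain rfl : t = t₀ := ht; exact hF x hx)
  have hreg : ∀ t ∈ I, ∀ x ∈ K, ContDiffAt ℝ 1 (fun z : ℝ × Space d => F z.1 z.2) (t, x) :=
    fun t ht x hx => hIV (mk_mem_prod ht (hKV hx))
  obtain ⟨ε, hε, hεI⟩ := Metric.nhds_basis_closedBall.mem_iff.1 (hI.mem_nhds (htI rfl))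
  have hF'c : ∀ t ∈ I, ∀ x ∈ K, ContinuousAt F' (t, x) := fun t ht x hx =>
    contDiffAt_continuousAt_fderiv_apply (hreg t ht x hx) _
  obtain ⟨C, hC⟩ := ((isCompact_closedBall t₀ ε).prod hK).exists_bound_of_continuousOn (f := F')
    fun z hz => (hF'c z.1 (hεI hz.1) z.2 hz.2).continuousWithinAt
  have hFc : ∀ t ∈ I, ContinuousOn (F t) K := fun t ht x hx =>
    (ContinuousAt.comp (f := fun y => (t, y)) (hreg t ht x hx).continuousAt
      (by fun_prop)).continuousWithinAt
  have hint : ∀ t ∈ I, IntegrableOn (F t) A := fun t ht =>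
    ((hFc t ht).integrableOn_compact hK).mono_set hAK
  have ht₀ : t₀ ∈ I := htI rfl
  have hev : ∀ᶠ t in 𝓝 t₀, IntegrableOn (F t) A := by
    filter_upwards [hI.mem_nhds ht₀] with t ht using hint t ht
  have hF'int : IntegrableOn (fun x => F' (t₀, x)) A := by
    refine IntegrableOn.mono_set (ContinuousOn.integrableOn_compact hK fun x hx => ?_) hAK
    exact (ContinuousAt.comp (f := fun y => (t₀, y)) (hF'c t₀ ht₀ x hx)
      (by fun_prop)).continuousWithinAt
  have hfin : volume A < ⊤ := (measure_mono hAK).trans_lt hK.measure_lt_top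
  have key := (hasDerivAt_integral_of_dominated_loc_of_deriv_le (μ := volume.restrict A)
    (F := F) (F' := fun t x => F' (t, x)) (bound := fun _ => C)
    (Metric.closedBall_mem_nhds t₀ hε) (hev.mono fun t ht => ht.aestronglyMeasurable)
    (hint t₀ ht₀) hF'int.aestronglyMeasurable
    ((ae_restrict_mem hA).mono fun x hx t ht => hC (t, x) (mk_mem_prod ht (hAK hx)))
    (integrableOn_const hfin.ne)
    ((ae_restrict_mem hA).mono fun x hx t ht =>
      ContDiffAt.hasDerivAt_slice (hreg t (hεI ht) x (hAK hx)))).2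
  have heq : ∀ x ∈ A, F' (t₀, x) = deriv (fun τ => F τ x) t₀ := fun x hx =>
    (ContDiffAt.hasDerivAt_slice (hreg t₀ ht₀ x (hAK hx))).deriv.symm
  refine ⟨hev, hF'int.congr_fun heq hA, ?_⟩
  rwa [setIntegral_congr_fun hA heq] at key

/-! ### Companion conservation laws -/

/-- A scalar density `σ` with flux `Φ` and multiplier `ψ`: every smooth solution of the system
satisfies the scalar balance law `∂_t σ + ∑ i, ∂_i (Φ i) = 0`, obtained by multiplication by `ψ`. -/
structure IsCompanionLaw {d p : ℕ} (L : EntropySystem d p) (σ : State p → ℝ)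
    (Φ : Fin d → State p → ℝ) (ψ : State p → State p) : Prop where
  contDiffOn_σ : ContDiffOn ℝ 1 σ L.adm
  contDiffOn_Φ : ∀ i, ContDiffOn ℝ 1 (Φ i) L.adm
  continuousOn_ψ : ContinuousOn ψ L.adm
  fderiv_σ : ∀ ω ∈ L.adm, ∀ h, fderiv ℝ σ ω h = inner ℝ (ψ ω) h
  fderiv_Φ : ∀ ω ∈ L.adm, ∀ i, ∀ h, fderiv ℝ (Φ i) ω h = inner ℝ (ψ ω) (fderiv ℝ (L.f i) ω h)

theorem EntropySystem.isCompanionLaw_entropy {d p : ℕ} (L : EntropySystem d p) :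
    IsCompanionLaw L L.s L.fε L.w where
  contDiffOn_σ := L.contDiffOn_s
  contDiffOn_Φ := L.contDiffOn_fε
  continuousOn_ψ := (InnerProductSpace.toDual ℝ (State p)).symm.continuous.comp_continuousOn
    (L.contDiffOn_s.continuousOn_fderiv_of_isOpen L.isOpen_adm le_rfl)
  fderiv_σ ω _ h := by simp [EntropySystem.w, gradient]
  fderiv_Φ := L.entropy_flux

/-- Constant multipliers recover the system itself, one direction `c` at a time; this is the route
to conservation. -/
theorem EntropySystem.isCompanionLaw_inner {d p : ℕ} (L : EntropySystem d p) (c : State p) :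
    IsCompanionLaw L (fun ω => inner ℝ c ω) (fun i ω => inner ℝ c (L.f i ω)) (fun _ => c) where
  contDiffOn_σ := (innerSL ℝ c).contDiff.contDiffOn
  contDiffOn_Φ i := (innerSL ℝ c).contDiff.comp_contDiffOn (L.contDiffOn_f i)
  continuousOn_ψ := continuousOn_const
  fderiv_σ ω _ h := by
    have := (innerSL ℝ c).hasFDerivAt (x := ω)
    rw [show (fun ω => inner ℝ c ω) = innerSL ℝ c from rfl, this.fderiv]; rfl
  fderiv_Φ ω hω i h := by
    have := (innerSL ℝ c).hasFDerivAt.comp ω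
      (((L.contDiffOn_f i).contDiffAt (L.isOpen_adm.mem_nhds hω)).differentiableAt
        one_ne_zero).hasFDerivAt
    rw [show (fun ω => inner ℝ c (L.f i ω)) = innerSL ℝ c ∘ L.f i from rfl, this.fderiv]; rfl

namespace IsRegular

variable {d p : ℕ} {L : EntropySystem d p} {T : ℝ} {Ω : Set (Space d)}
  {u : ℝ → Space d → State p}

theorem mono (h : IsRegular L T Ω u) {Ω' : Set (Space d)} (hs : Ω' ⊆ Ω) : IsRegular L T Ω' u :=
  fun t ht x hx => h t ht x (closure_mono hs hx)

theorem contDiffAt_slice (h : IsRegular L T Ω u) {t : ℝ} (ht : t ∈ Icc 0 T) {x : Space d}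
    (hx : x ∈ closure Ω) : ContDiffAt ℝ 1 (u t) x :=
  ContDiffAt.comp (f := fun y => (t, y)) x (h t ht x hx).1 (contDiffAt_const.prodMk contDiffAt_id)

theorem contDiffAt_comp (h : IsRegular L T Ω u) {E : Type*} [NormedAddCommGroup E]
    [NormedSpace ℝ E] {σ : State p → E} (hσ : ContDiffOn ℝ 1 σ L.adm) {t : ℝ} (ht : t ∈ Icc 0 T)
    {x : Space d} (hx : x ∈ closure Ω) :
    ContDiffAt ℝ 1 (fun z : ℝ × Space d => σ (u z.1 z.2)) (t, x) :=
  ContDiffAt.comp (t, x) (f := fun z : ℝ × Space d => u z.1 z.2)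
    (hσ.contDiffAt (L.isOpen_adm.mem_nhds (h t ht x hx).2)) (h t ht x hx).1

theorem contDiffAt_comp_slice (h : IsRegular L T Ω u) {E : Type*} [NormedAddCommGroup E]
    [NormedSpace ℝ E] {σ : State p → E} (hσ : ContDiffOn ℝ 1 σ L.adm) {t : ℝ} (ht : t ∈ Icc 0 T)
    {x : Space d} (hx : x ∈ closure Ω) : ContDiffAt ℝ 1 (fun y => σ (u t y)) x :=
  ContDiffAt.comp x (hσ.contDiffAt (L.isOpen_adm.mem_nhds (h t ht x hx).2))
    (h.contDiffAt_slice ht hx)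

theorem continuousOn_slice (h : IsRegular L T Ω u) {t : ℝ} (ht : t ∈ Icc 0 T) :
    ContinuousOn (u t) (closure Ω) :=
  fun _ hx => (h.contDiffAt_slice ht hx).continuousAt.continuousWithinAt

theorem mapsTo (h : IsRegular L T Ω u) {t : ℝ} (ht : t ∈ Icc 0 T) :
    MapsTo (u t) (closure Ω) L.adm :=
  fun x hx => (h t ht x hx).2

/-- The residual multiplied by `ψ` is the residual of the companion law. -/
theorem inner_residual (h : IsRegular L T Ω u) {σ : State p → ℝ} {Φ : Fin d → State p → ℝ}
    {ψ : State p → State p} (hL : IsCompanionLaw L σ Φ ψ) {t : ℝ} (ht : t ∈ Icc 0 T)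
    {x : Space d} (hx : x ∈ closure Ω) :
    inner ℝ (ψ (u t x)) (residual L u t x) = deriv (fun τ => σ (u τ x)) t +
      ∑ i, fderiv ℝ (fun y => Φ i (u t y)) x (EuclideanSpace.single i 1) := by
  obtain ⟨hu, hadm⟩ := h t ht x hx
  have hn := L.isOpen_adm.mem_nhds hadm
  have hut := (ContDiffAt.hasDerivAt_slice hu).differentiableAt.hasDerivAt
  have hux := ((h.contDiffAt_slice ht hx).differentiableAt one_ne_zero).hasFDerivAt
  rw [residual, inner_add_right, inner_sum]
  congr 1
  · rw [← hL.fderiv_σ _ hadm]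
    exact ((((hL.contDiffOn_σ.contDiffAt hn).differentiableAt
      one_ne_zero).hasFDerivAt).comp_hasDerivAt t hut).deriv.symm
  · refine Finset.sum_congr rfl fun i _ => ?_
    have h1 := (((L.contDiffOn_f i).contDiffAt hn).differentiableAt one_ne_zero).hasFDerivAt.comp
      x hux
    have h2 := (((hL.contDiffOn_Φ i).contDiffAt hn).differentiableAt one_ne_zero).hasFDerivAt.comp
      x hux
    rw [show (fun y => L.f i (u t y)) = L.f i ∘ u t from rfl, h1.fderiv,
      show (fun y => Φ i (u t y)) = Φ i ∘ u t from rfl, h2.fderiv,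
      ContinuousLinearMap.comp_apply, ContinuousLinearMap.comp_apply, hL.fderiv_Φ _ hadm]

theorem hasDerivAt_setIntegral (h : IsRegular L T Ω u) (hb : Bornology.IsBounded Ω)
    {A : Set (Space d)} (hA : MeasurableSet A) (hs : A ⊆ Ω) {E : Type*} [NormedAddCommGroup E]
    [NormedSpace ℝ E] [CompleteSpace E] {σ : State p → E} (hσ : ContDiffOn ℝ 1 σ L.adm) {t : ℝ}
    (ht : t ∈ Icc 0 T) :
    (∀ᶠ τ in 𝓝 t, IntegrableOn (fun x => σ (u τ x)) A) ∧
    IntegrableOn (fun x => deriv (fun τ => σ (u τ x)) t) A ∧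
    HasDerivAt (fun τ => ∫ x in A, σ (u τ x)) (∫ x in A, deriv (fun τ => σ (u τ x)) t) t :=
  hasDerivAt_setIntegral_of_contDiffAt (F := fun t x => σ (u t x)) hA hb.isCompact_closure
    (hs.trans subset_closure) fun _ hx => h.contDiffAt_comp hσ ht hx

theorem integral_inner_residual (h : IsRegular L T Ω u) (ho : IsOpen Ω)
    (hb : Bornology.IsBounded Ω) {σ : State p → ℝ} {Φ : Fin d → State p → ℝ}
    {ψ : State p → State p} (hL : IsCompanionLaw L σ Φ ψ) {t : ℝ} (ht : t ∈ Icc 0 T) :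
    ∫ x in Ω, inner ℝ (ψ (u t x)) (residual L u t x) =
      (∫ x in Ω, deriv (fun τ => σ (u τ x)) t) +
        ∑ i, ∫ x in Ω, fderiv ℝ (fun y => Φ i (u t y)) x (EuclideanSpace.single i 1) := by
  have hi : ∀ i ∈ Finset.univ, IntegrableOn (fun x => fderiv ℝ (fun y => Φ i (u t y)) x
      (EuclideanSpace.single i 1)) Ω := fun i _ =>
    integrableOn_fderiv_apply hb (fun x hx => h.contDiffAt_comp_slice (hL.contDiffOn_Φ i) ht hx) _
  rw [setIntegral_congr_fun ho.measurableSet fun x hx =>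
      h.inner_residual hL ht (subset_closure hx),
    integral_add (h.hasDerivAt_setIntegral hb ho.measurableSet subset_rfl hL.contDiffOn_σ ht).2.1
      (integrable_finsetSum _ hi), integral_finsetSum _ hi]

end IsRegular

/-! ### Surface integrals of normal components -/

theorem inner_normalComp {d p : ℕ} (n : Space d) (y : State p) (g : Fin d → State p) :
    inner ℝ y (normalComp n g) = normalComp n fun i => inner ℝ y (g i) := by
  simp [normalComp, inner_sum, inner_smul_right]

namespace IsOuterUnitNormal

variable {d : ℕ} {Ω : Set (Space d)} {n : Space d → Space d} {V : Type*} [NormedAddCommGroup V]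
  [NormedSpace ℝ V] {Γ : Set (Space d)}

theorem integrableOn_normalComp (hn : IsOuterUnitNormal Ω n) (hΓ : Γ ⊆ frontier Ω)
    (hc : IsCompact Γ) {g : Space d → Fin d → V} (hg : ∀ i, ContinuousOn (fun x => g x i) Γ) :
    IntegrableOn (fun x => normalComp (n x) (g x)) Γ (surf d) :=
  integrable_finsetSum _ fun i _ => hn.integrableOn_smul hΓ hc (hg i) i

theorem integral_normalComp [CompleteSpace V] (hn : IsOuterUnitNormal Ω n) (hΓ : Γ ⊆ frontier Ω)
    (hc : IsCompact Γ) {g : Space d → Fin d → V} (hg : ∀ i, ContinuousOn (fun x => g x i) Γ) :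
    ∫ x in Γ, normalComp (n x) (g x) ∂(surf d) = ∑ i, ∫ x in Γ, n x i • g x i ∂(surf d) :=
  integral_finsetSum _ fun i _ => hn.integrableOn_smul hΓ hc (hg i) i

/-- Dominated convergence, with a constant bound from compactness of `I ×ˢ Γ` and finite area. It
makes the boundary entropy flux integrable in time. -/
theorem continuousOn_integral_normalComp [CompleteSpace V] (hn : IsOuterUnitNormal Ω n)
    (hΓ : Γ ⊆ frontier Ω) (hc : IsCompact Γ) {I : Set ℝ} (hI : IsCompact I)
    {g : ℝ → Space d → Fin d → V}
    (hg : ∀ i, ContinuousOn (fun z : ℝ × Space d => g z.1 z.2 i) (I ×ˢ Γ)) :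
    ContinuousOn (fun t => ∫ x in Γ, normalComp (n x) (g t x) ∂(surf d)) I := by
  have hx : ∀ t ∈ I, ∀ i, ContinuousOn (fun x => g t x i) Γ := fun t ht i =>
    (hg i).comp (f := fun x => (t, x)) (by fun_prop) fun x hx => mk_mem_prod ht hx
  refine (continuousOn_finsetSum Finset.univ fun i _ => ?_).congr fun t ht =>
    hn.integral_normalComp hΓ hc (hx t ht)
  have := hn.isFiniteMeasure
  have hle : (surf d).restrict Γ ≤ (surf d).restrict (frontier Ω) := Measure.restrict_mono hΓ le_rfl
  have : IsFiniteMeasure ((surf d).restrict Γ) := isFiniteMeasure_of_le _ hle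
  obtain ⟨C, hC⟩ := (hI.prod hc).exists_bound_of_continuousOn (hg i)
  refine continuousOn_of_dominated (bound := fun _ => C)
    (fun t ht => (hn.integrableOn_smul hΓ hc (hx t ht i) i).aestronglyMeasurable) (fun t ht => ?_)
    (integrable_const C) ?_
  · filter_upwards [ae_mono hle (hn.norm_apply_le i), ae_restrict_mem hc.measurableSet] with x h1 h2
    rw [norm_smul]
    calc _ ≤ 1 * C := mul_le_mul h1 (hC (t, x) (mk_mem_prod ht h2)) (norm_nonneg _) zero_le_one
      _ = C := one_mul C
  · filter_upwards [ae_restrict_mem hc.measurableSet] with x hx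
    exact ((hg i).comp (f := fun t => (t, x)) (by fun_prop) fun t ht =>
      mk_mem_prod ht hx).const_smul _

end IsOuterUnitNormal

end Overset

/-! ### Compactness of the boundary pieces -/

namespace Overset

open Filter Topology Metric

/-- Away from `frontier W`, membership in `W` and in `closure W` coincide. Disjointness of the
boundaries thus makes the interfaces compact, although each is cut out by an open set. -/
theorem isCompact_inter_of_disjoint_frontier {X : Type*} [TopologicalSpace X] {F W : Set X}
    (hF : IsCompact F) (hd : Disjoint F (frontier W)) : IsCompact (F ∩ W) := by
  have : F ∩ W = F ∩ closure W := by
    rw [closure_eq_self_union_frontier, inter_union_distrib_left, hd.inter_eq, union_empty]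
  exact this ▸ hF.inter_right isClosed_closure

namespace Geometry

variable {d : ℕ} (G : Geometry d)

theorem isCompact_Γa : IsCompact G.Γa :=
  (isCompact_frontier_of_isBounded G.bounded_u).diff G.isOpen_v

theorem isCompact_Γd : IsCompact G.Γd :=
  (isCompact_frontier_of_isBounded G.bounded_v).diff G.isOpen_u

theorem isCompact_Γb : IsCompact G.Γb :=
  isCompact_inter_of_disjoint_frontier (isCompact_frontier_of_isBounded G.bounded_v)
    G.disjoint_frontier.symm

theorem isCompact_Γc : IsCompact G.Γc :=
  isCompact_inter_of_disjoint_frontier (isCompact_frontier_of_isBounded G.bounded_u)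
    G.disjoint_frontier

theorem Γa_subset : G.Γa ⊆ frontier G.Ωu := sdiff_subset
theorem Γb_subset : G.Γb ⊆ frontier G.Ωv := inter_subset_left
theorem Γc_subset : G.Γc ⊆ frontier G.Ωu := inter_subset_left
theorem Γd_subset : G.Γd ⊆ frontier G.Ωv := sdiff_subset

theorem Γa_subset_closure : G.Γa ⊆ closure G.Ωu := G.Γa_subset.trans frontier_subset_closure
theorem Γd_subset_closure : G.Γd ⊆ closure G.Ωv := G.Γd_subset.trans frontier_subset_closure

end Geometry

/-! ### Balance of a companion law on the subdomains -/

/-- `W` stands for the other subdomain, so the boundary splits into its artificial part inside `W`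
and its physical part outside. -/
theorem IsRegular.integral_inner_residual_eq_boundary {d p : ℕ} {L : EntropySystem d p} {T : ℝ}
    {Ω W : Set (Space d)} {n : Space d → Space d} {u : ℝ → Space d → State p}
    (h : IsRegular L T Ω u) (ho : IsOpen Ω) (hb : Bornology.IsBounded Ω)
    (hn : IsOuterUnitNormal Ω n) (hW : IsOpen W) {σ : State p → ℝ} {Φ : Fin d → State p → ℝ}
    {ψ : State p → State p} (hL : IsCompanionLaw L σ Φ ψ) {t : ℝ} (ht : t ∈ Icc 0 T) :
    ∫ x in Ω, inner ℝ (ψ (u t x)) (residual L u t x) =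
      (∫ x in Ω, deriv (fun τ => σ (u τ x)) t) +
        ((∫ x in frontier Ω ∩ W, normalComp (n x) (fun i => Φ i (u t x)) ∂(surf d)) +
          ∫ x in frontier Ω \ W, normalComp (n x) (fun i => Φ i (u t x)) ∂(surf d)) := by
  have hc := isCompact_frontier_of_isBounded hb
  have hΦ : ∀ i, ∀ x ∈ closure Ω, ContDiffAt ℝ 1 (fun y => Φ i (u t y)) x := fun i x hx =>
    h.contDiffAt_comp_slice (hL.contDiffOn_Φ i) ht hx
  have hg : ∀ i, ContinuousOn (fun x => Φ i (u t x)) (frontier Ω) := fun i x hx =>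
    (hΦ i x (frontier_subset_closure hx)).continuousAt.continuousWithinAt
  rw [h.integral_inner_residual ho hb hL ht, integral_inter_add_sdiff hW.measurableSet
    (hn.integrableOn_normalComp subset_rfl hc hg), hn.integral_normalComp subset_rfl hc hg]
  congr 1
  exact Finset.sum_congr rfl fun i _ => hn.integral_fderiv ho hb (hΦ i) i

theorem IsRegular.integral_inner_residual_overlap {d p : ℕ} {L : EntropySystem d p} {T : ℝ}
    {G : Geometry d} {u : ℝ → Space d → State p} (h : IsRegular L T G.ΩO u)
    (hb : G.Γb ⊆ closure G.ΩO) (hc : G.Γc ⊆ closure G.ΩO) {σ : State p → ℝ}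
    {Φ : Fin d → State p → ℝ} {ψ : State p → State p} (hL : IsCompanionLaw L σ Φ ψ) {t : ℝ}
    (ht : t ∈ Icc 0 T) :
    ∫ x in G.ΩO, inner ℝ (ψ (u t x)) (residual L u t x) =
      (∫ x in G.ΩO, deriv (fun τ => σ (u τ x)) t) +
        ((∫ x in G.Γc, normalComp (G.nu x) (fun i => Φ i (u t x)) ∂(surf d)) +
          ∫ x in G.Γb, normalComp (G.nv x) (fun i => Φ i (u t x)) ∂(surf d)) := by
  have hΦ : ∀ i, ∀ x ∈ closure G.ΩO, ContDiffAt ℝ 1 (fun y => Φ i (u t y)) x := fun i x hx =>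
    h.contDiffAt_comp_slice (hL.contDiffOn_Φ i) ht hx
  have hg : ∀ i, ContinuousOn (fun x => Φ i (u t x)) (closure G.ΩO) := fun i x hx =>
    (hΦ i x hx).continuousAt.continuousWithinAt
  rw [h.integral_inner_residual G.isOpen_ΩO G.bounded_ΩO hL ht,
    G.normal_u.integral_normalComp G.Γc_subset G.isCompact_Γc fun i => (hg i).mono hc,
    G.normal_v.integral_normalComp G.Γb_subset G.isCompact_Γb fun i => (hg i).mono hb,
    ← Finset.sum_add_distrib]
  congr 1
  exact Finset.sum_congr rfl fun i _ => G.integral_fderiv_ΩO (hΦ i) i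

namespace Geometry

variable {d : ℕ} (G : Geometry d)

theorem Γb_subset_closure_ΩO : G.Γb ⊆ closure G.ΩO := fun _ hx =>
  G.isOpen_u.inter_closure ⟨hx.2, frontier_subset_closure hx.1⟩

theorem Γc_subset_closure_ΩO : G.Γc ⊆ closure G.ΩO := fun _ hx =>
  closure_mono (inter_comm G.Ωv G.Ωu).subset
    (G.isOpen_v.inter_closure ⟨hx.2, frontier_subset_closure hx.1⟩)

end Geometry

/-! ### Interface terms -/

/-- The interface term of a companion law. -/
noncomputable def interfaceTerm {d p : ℕ} (Φ : Fin d → State p → ℝ) (ψ : State p → State p) (β : ℝ)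
    (n : Space d) (Pu Pv : Fin d → State p → State p → State p) (a c : State p) : ℝ :=
  normalComp (β • n) (fun i => Φ i a - Φ i c) + inner ℝ (ψ a) (normalComp n fun i => Pu i a c) +
    inner ℝ (ψ c) (normalComp n fun i => Pv i a c)

/-- Pairing with `y` makes the vector-valued conservation condition an instance of the scalar
interface term with constant multiplier. -/
theorem inner_interfaceFlux {d p : ℕ} (L : EntropySystem d p) (y : State p) (β : ℝ) (n : Space d)
    (Pu Pv : Fin d → State p → State p → State p) (a c : State p) :
    inner ℝ y (interfaceFlux L β n Pu Pv a c) =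
      interfaceTerm (fun i ω => inner ℝ y (L.f i ω)) (fun _ => y) β n Pu Pv a c := by
  simp only [interfaceFlux, interfaceTerm, inner_add_right, inner_normalComp, inner_sub_right]

theorem normalComp_smul_sub {d : ℕ} {V : Type*} [AddCommGroup V] [Module ℝ V] (β : ℝ)
    (n : Space d) (g h : Fin d → V) :
    normalComp (β • n) (fun i => g i - h i) = β • (normalComp n g - normalComp n h) := by
  simp only [normalComp, ← Finset.sum_sub_distrib, Finset.smul_sum, ← smul_sub, PiLp.smul_apply,
    smul_eq_mul, mul_smul]

/-- Each summand is continuous data on a compact interface paired with the bounded normal, hence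
separately integrable; this separates the flux integrals from the penalty integrals of the weak
form. -/
theorem IsOuterUnitNormal.integral_interfaceTerm {d p : ℕ} {Ω : Set (Space d)}
    {n : Space d → Space d} (hn : IsOuterUnitNormal Ω n) {Γ : Set (Space d)} (hΓ : Γ ⊆ frontier Ω)
    (hc : IsCompact Γ) {L : EntropySystem d p} {σ : State p → ℝ} {Φ : Fin d → State p → ℝ}
    {ψ : State p → State p} (hL : IsCompanionLaw L σ Φ ψ) (β : ℝ)
    {Pu Pv : Fin d → State p → State p → State p}
    (hPu : ∀ i, ContinuousOn (fun z : State p × State p => Pu i z.1 z.2) (L.adm ×ˢ L.adm))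
    (hPv : ∀ i, ContinuousOn (fun z : State p × State p => Pv i z.1 z.2) (L.adm ×ˢ L.adm))
    {a c : Space d → State p} (ha : ContinuousOn a Γ) (hcc : ContinuousOn c Γ)
    (ha' : MapsTo a Γ L.adm) (hc' : MapsTo c Γ L.adm) :
    ∫ x in Γ, interfaceTerm Φ ψ β (n x) Pu Pv (a x) (c x) ∂(surf d) =
      β * ((∫ x in Γ, normalComp (n x) (fun i => Φ i (a x)) ∂(surf d)) -
        ∫ x in Γ, normalComp (n x) (fun i => Φ i (c x)) ∂(surf d)) +
      (∫ x in Γ, inner ℝ (ψ (a x)) (normalComp (n x) fun i => Pu i (a x) (c x)) ∂(surf d)) +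
      ∫ x in Γ, inner ℝ (ψ (c x)) (normalComp (n x) fun i => Pv i (a x) (c x)) ∂(surf d) := by
  have hac : ContinuousOn (fun x => (a x, c x)) Γ := ha.prodMk hcc
  have hac' : MapsTo (fun x => (a x, c x)) Γ (L.adm ×ˢ L.adm) := fun x hx => ⟨ha' hx, hc' hx⟩
  have i1 := hn.integrableOn_normalComp hΓ hc (g := fun x i => Φ i (a x))
    fun i => (hL.contDiffOn_Φ i).continuousOn.comp ha ha'
  have i2 := hn.integrableOn_normalComp hΓ hc (g := fun x i => Φ i (c x))
    fun i => (hL.contDiffOn_Φ i).continuousOn.comp hcc hc'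
  have i3 := hn.integrableOn_normalComp hΓ hc (g := fun x i => inner ℝ (ψ (a x)) (Pu i (a x) (c x)))
    fun i => (hL.continuousOn_ψ.comp ha ha').inner ((hPu i).comp hac hac')
  have i4 := hn.integrableOn_normalComp hΓ hc (g := fun x i => inner ℝ (ψ (c x)) (Pv i (a x) (c x)))
    fun i => (hL.continuousOn_ψ.comp hcc hc').inner ((hPv i).comp hac hac')
  simp only [interfaceTerm, normalComp_smul_sub, inner_normalComp, smul_eq_mul]
  have i12 := (i1.sub i2).const_mul β
  have i123 := i12.add i3
  simp only [Pi.sub_apply] at i12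
  rw [integral_add (by exact i123) i4, integral_add i12 i3, integral_const_mul, integral_sub i1 i2]

/-! ### The overset balance -/

section Balance

variable {d p : ℕ} {L : EntropySystem d p} {G : Geometry d} {P : InterfacePenalties L}
  {Q : InteriorPenalties p G} {u v : ℝ → Space d → State p} {T : ℝ}
  {𝒯u 𝒯v : Submodule ℝ (ℝ → Space d → State p)}

/-- The total amount of the density `σ`, the overlap being counted once. -/
noncomputable def totalDensity (G : Geometry d) (u v : ℝ → Space d → State p) (σ : State p → ℝ)
    (η t : ℝ) : ℝ :=
  (∫ x in G.Ωu, σ (u t x)) + (∫ x in G.Ωv, σ (v t x)) -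
    (η * (∫ x in G.ΩO, σ (u t x)) + (1 - η) * ∫ x in G.ΩO, σ (v t x))

theorem IsWeakSolution.hasDerivAt_totalDensity (hsol : IsWeakSolution L G P Q u v T 𝒯u 𝒯v)
    {σ : State p → ℝ} {Φ : Fin d → State p → ℝ} {ψ : State p → State p}
    (hL : IsCompanionLaw L σ Φ ψ) (hψu : (fun t x => ψ (u t x)) ∈ 𝒯u)
    (hψv : (fun t x => ψ (v t x)) ∈ 𝒯v) (η : ℝ) {t : ℝ} (ht : t ∈ Icc 0 T) :
    HasDerivAt (totalDensity G u v σ η)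
      (-((∫ x in G.Γa, normalComp (G.nu x) (fun i => Φ i (u t x)) ∂(surf d)) +
          ∫ x in G.Γd, normalComp (G.nv x) (fun i => Φ i (v t x)) ∂(surf d)) -
        ((1 - η) * interiorU L G Q u v (fun x => ψ (u t x)) t +
          η * interiorV L G Q u v (fun x => ψ (v t x)) t) -
        (∫ x in G.Γb, interfaceTerm Φ ψ (-η) (G.nv x) P.bu P.bv (u t x) (v t x) ∂(surf d)) -
        ∫ x in G.Γc, interfaceTerm Φ ψ (1 - η) (G.nu x) P.cu P.cv (u t x) (v t x) ∂(surf d)) t := by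
  have hu := hsol.regular_u
  have hv := hsol.regular_v
  have huO : IsRegular L T G.ΩO u := hu.mono inter_subset_left
  have hvO : IsRegular L T G.ΩO v := hv.mono inter_subset_right
  have hσ := hL.contDiffOn_σ
  have du := (hu.hasDerivAt_setIntegral G.bounded_u G.isOpen_u.measurableSet subset_rfl hσ ht).2.2
  have dv := (hv.hasDerivAt_setIntegral G.bounded_v G.isOpen_v.measurableSet subset_rfl hσ ht).2.2
  have duO := (huO.hasDerivAt_setIntegral G.bounded_ΩO G.isOpen_ΩO.measurableSet subset_rfl hσ
    ht).2.2
  have dvO := (hvO.hasDerivAt_setIntegral G.bounded_ΩO G.isOpen_ΩO.measurableSet subset_rfl hσ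
    ht).2.2
  refine ((du.add dv).sub ((duO.const_mul η).add (dvO.const_mul (1 - η)))).congr_deriv ?_
  have eu := hsol.eq_u _ hψu t ht
  have ev := hsol.eq_v _ hψv t ht
  have euO := hsol.eq_u_overlap _ hψu t ht
  have evO := hsol.eq_v_overlap _ hψv t ht
  have cb := G.Γb_subset_closure_ΩO
  have cc := G.Γc_subset_closure_ΩO
  rw [hu.integral_inner_residual_eq_boundary G.isOpen_u G.bounded_u G.normal_u G.isOpen_v hL ht,
    ← Geometry.Γa, ← Geometry.Γc] at eu
  rw [hv.integral_inner_residual_eq_boundary G.isOpen_v G.bounded_v G.normal_v G.isOpen_u hL ht,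
    ← Geometry.Γd, ← Geometry.Γb] at ev
  rw [huO.integral_inner_residual_overlap cb cc hL ht] at euO
  rw [hvO.integral_inner_residual_overlap cb cc hL ht] at evO
  have cu := huO.continuousOn_slice ht
  have cv := hvO.continuousOn_slice ht
  have mu := huO.mapsTo ht
  have mv := hvO.mapsTo ht
  rw [G.normal_v.integral_interfaceTerm G.Γb_subset G.isCompact_Γb hL (-η) P.continuousOn_bu
      P.continuousOn_bv (cu.mono cb) (cv.mono cb) (mu.mono_left cb) (mv.mono_left cb),
    G.normal_u.integral_interfaceTerm G.Γc_subset G.isCompact_Γc hL (1 - η) P.continuousOn_cu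
      P.continuousOn_cv (cu.mono cc) (cv.mono cc) (mu.mono_left cc) (mv.mono_left cc)]
  -- On `Γc` the `u`-flux has weight `1 - η` and the `v`-flux `-(1 - η)`; on `Γb` the weights are
  -- `-η` and `1 - (1 - η) = η`. Interface penalties occur only in `eu` and `ev`, so they keep
  -- weight 1, whereas the interior terms of `u` and `v` retain `1 - η` and `η`.
  linear_combination eu + ev - η * euO - (1 - η) * evO

theorem totalEntropy_eq_totalDensity (η : ℝ) {t : ℝ}
    (hu : IntegrableOn (fun x => L.s (u t x)) G.Ωu) (hv : IntegrableOn (fun x => L.s (v t x)) G.Ωv) :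
    totalEntropy L G u v η t = totalDensity G u v L.s η t := by
  have mu := G.isOpen_u.measurableSet
  have mv := G.isOpen_v.measurableSet
  have mO := G.isOpen_ΩO.measurableSet
  have huO : IntegrableOn (fun x => L.s (u t x)) G.ΩO := hu.mono_set inter_subset_left
  have hvO : IntegrableOn (fun x => L.s (v t x)) G.ΩO := hv.mono_set inter_subset_right
  have hO := (huO.const_mul η).add (hvO.const_mul (1 - η))
  rw [totalEntropy, totalDensity, ← integral_const_mul, ← integral_const_mul,
    ← integral_add (huO.const_mul η) (hvO.const_mul (1 - η)), ← integral_indicator mu,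
    ← integral_indicator mv, ← integral_indicator mO,
    ← integral_indicator (show MeasurableSet G.Ω from mu.union mv),
    ← integral_add (hu.integrable_indicator mu) (hv.integrable_indicator mv),
    ← integral_sub (by exact (hu.integrable_indicator mu).add (hv.integrable_indicator mv))
      (by exact IntegrableOn.integrable_indicator hO mO)]
  congr 1
  ext x
  -- Inclusion-exclusion pointwise. Only the overlap needs algebra: `s(u) + s(v) - η s(u) - (1-η)
  -- s(v)` is the weighted density.
  by_cases h1 : x ∈ G.Ωu <;> by_cases h2 : x ∈ G.Ωv <;>
    simp [Geometry.Ω, Geometry.ΩO, overlapEntropy, h1, h2]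
  ring

theorem inner_totalState (c : State p) (η : ℝ) {t : ℝ} (hu : IntegrableOn (u t) G.Ωu)
    (hv : IntegrableOn (v t) G.Ωv) :
    inner ℝ c (totalState G u v η t) = totalDensity G u v (fun ω => inner ℝ c ω) η t := by
  have huO : IntegrableOn (u t) G.ΩO := hu.mono_set inter_subset_left
  have hvO : IntegrableOn (v t) G.ΩO := hv.mono_set inter_subset_right
  have e : ∀ (w : Space d → State p) (A : Set (Space d)), IntegrableOn w A →
      ∫ x in A, inner ℝ c (w x) = inner ℝ c (∫ x in A, w x) := fun w A hw =>
    (innerSL ℝ c).integral_comp_comm hw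
  rw [totalDensity, e _ _ hu, e _ _ hv, e _ _ huO, e _ _ hvO, totalState]
  simp only [inner_sub_right, inner_add_right, inner_smul_right]

/-! ### Interior penalties under the matrix coupling -/

theorem interior_entropy_eq_dissipation (η t : ℝ) :
    (1 - η) * interiorU L G Q u v (fun x => L.w (u t x)) t +
      η * interiorV L G Q u v (fun x => L.w (v t x)) t = dissipation L G Q u v η t := by
  simp only [interiorU, interiorV, dissipation, pointDissipation, Finset.sum_add_distrib,
    ← Finset.mul_sum]
  ring

/-- The coupling of the penalty matrices makes the two interior penalties cancel. -/
theorem coupling_act {A B : Matrix (Fin p) (Fin p) ℝ} {η : ℝ} (h : (1 - η) • A = η • B)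
    (y z : State p) : (1 - η) * inner ℝ y (act A z) = η * inner ℝ y (act B z) := by
  have := congrArg (fun M : Matrix (Fin p) (Fin p) ℝ => inner ℝ y (act M z)) h
  simpa [act, inner_smul_right] using this

theorem act_sub_comm (A : Matrix (Fin p) (Fin p) ℝ) (y z : State p) :
    act A (y - z) = -act A (z - y) := by
  rw [← neg_sub, act, map_neg, act]

/-- The two equations are penalized by opposite jumps, and the weighted matrices coincide, so with a
common test vector the contributions cancel at every point. -/
theorem interior_const_eq_zero {η t : ℝ} (h : ∀ m, (1 - η) • Q.Su m t = η • Q.Sv m t)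
    (c : State p) :
    (1 - η) * interiorU L G Q u v (fun _ => c) t + η * interiorV L G Q u v (fun _ => c) t = 0 := by
  have e : ∀ m, (1 - η) * inner ℝ c (act (Q.Su m t) (L.w (u t (Q.pt m)) - L.w (v t (Q.pt m)))) +
      η * inner ℝ c (act (Q.Sv m t) (L.w (v t (Q.pt m)) - L.w (u t (Q.pt m)))) = 0 := fun m => by
    rw [coupling_act (h m), act_sub_comm (Q.Sv m t) (L.w (v t _)), inner_neg_right]
    ring
  have := Finset.sum_congr (rfl : (Finset.univ : Finset (Fin Q.M)) = _) fun m _ => e m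
  rw [Finset.sum_add_distrib, ← Finset.mul_sum, ← Finset.mul_sum, Finset.sum_const_zero] at this
  rw [interiorU, interiorV]
  linear_combination (1 / (Q.M : ℝ)) * this

/-- Replacing `η Σ_v` by `(1-η) Σ_u` leaves the same vector `Σ_u (w_u - w_v)` paired with `w_u` and
with `-w_v`. -/
theorem pointDissipation_eq {η t : ℝ} {m : Fin Q.M} (h : (1 - η) • Q.Su m t = η • Q.Sv m t) :
    pointDissipation L G Q u v η t m =
      (1 - η) * inner ℝ (L.w (u t (Q.pt m)) - L.w (v t (Q.pt m)))
        (act (Q.Su m t) (L.w (u t (Q.pt m)) - L.w (v t (Q.pt m)))) := by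
  rw [pointDissipation, ← coupling_act h, act_sub_comm (Q.Su m t) (L.w (v t _)), inner_neg_right,
    inner_sub_left]
  ring

theorem IsPosDef.inner_act_nonneg {A : Matrix (Fin p) (Fin p) ℝ} (hA : IsPosDef A) (y : State p) :
    0 ≤ inner ℝ y (act A y) := by
  by_cases hy : y = 0
  · simp [hy]
  · exact (hA y hy).le

/-! ### Rates of the total entropy and the total state -/

theorem IsWeakSolution.hasDerivAt_totalEntropy (hsol : IsWeakSolution L G P Q u v T 𝒯u 𝒯v)
    (hwu : (fun t x => L.w (u t x)) ∈ 𝒯u) (hwv : (fun t x => L.w (v t x)) ∈ 𝒯v) (η : ℝ) {t : ℝ}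
    (ht : t ∈ Icc 0 T) :
    HasDerivAt (totalEntropy L G u v η)
      (-boundaryEntropyFlux L G u v t - dissipation L G Q u v η t -
        (∫ x in G.Γb, interfaceEntropy L (-η) (G.nv x) P.bu P.bv (u t x) (v t x) ∂(surf d)) -
        ∫ x in G.Γc, interfaceEntropy L (1 - η) (G.nu x) P.cu P.cv (u t x) (v t x) ∂(surf d)) t := by
  have h := hsol.hasDerivAt_totalDensity L.isCompanionLaw_entropy hwu hwv η ht
  rw [interior_entropy_eq_dissipation] at h
  -- The two totals are identified where the densities are integrable, which is known for times near
  -- `t`; a derivative needs no more.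
  refine h.congr_of_eventuallyEq ?_
  filter_upwards [(hsol.regular_u.hasDerivAt_setIntegral G.bounded_u G.isOpen_u.measurableSet
    subset_rfl L.contDiffOn_s ht).1, (hsol.regular_v.hasDerivAt_setIntegral G.bounded_v
    G.isOpen_v.measurableSet subset_rfl L.contDiffOn_s ht).1] with τ h1 h2
  exact totalEntropy_eq_totalDensity η h1 h2

theorem inner_boundaryFlux (hu : IsRegular L T G.Ωu u) (hv : IsRegular L T G.Ωv v) (c : State p)
    {t : ℝ} (ht : t ∈ Icc 0 T) :
    inner ℝ c (boundaryFlux L G u v t) =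
      (∫ x in G.Γa, normalComp (G.nu x) (fun i => inner ℝ c (L.f i (u t x))) ∂(surf d)) +
        ∫ x in G.Γd, normalComp (G.nv x) (fun i => inner ℝ c (L.f i (v t x))) ∂(surf d) := by
  have ia := G.normal_u.integrableOn_normalComp G.Γa_subset G.isCompact_Γa
    (g := fun x i => L.f i (u t x)) fun i => (L.contDiffOn_f i).continuousOn.comp
      ((hu.continuousOn_slice ht).mono G.Γa_subset_closure)
      ((hu.mapsTo ht).mono_left G.Γa_subset_closure)
  have id := G.normal_v.integrableOn_normalComp G.Γd_subset G.isCompact_Γd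
    (g := fun x i => L.f i (v t x)) fun i => (L.contDiffOn_f i).continuousOn.comp
      ((hv.continuousOn_slice ht).mono G.Γd_subset_closure)
      ((hv.mapsTo ht).mono_left G.Γd_subset_closure)
  simp only [← inner_normalComp]
  rw [boundaryFlux, inner_add_right]
  exact congrArg₂ (· + ·) ((innerSL ℝ c).integral_comp_comm ia).symm
    ((innerSL ℝ c).integral_comp_comm id).symm

theorem IsWeakSolution.hasDerivAt_totalState (hsol : IsWeakSolution L G P Q u v T 𝒯u 𝒯v) {η : ℝ}
    (h𝒯u : IsTestSpace T G.Ωu 𝒯u) (h𝒯v : IsTestSpace T G.Ωv 𝒯v)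
    (hcoupling : ∀ m, ∀ t ∈ Icc 0 T, (1 - η) • Q.Su m t = η • Q.Sv m t)
    (hC : InterfaceConservative L G P u v T η) {t : ℝ} (ht : t ∈ Icc 0 T) :
    HasDerivAt (totalState G u v η) (-boundaryFlux L G u v t) t := by
  have hu := hsol.regular_u
  have hv := hsol.regular_v
  have hid : ContDiffOn ℝ 1 (fun ω : State p => ω) L.adm := contDiffOn_id
  have mu := G.isOpen_u.measurableSet
  have mv := G.isOpen_v.measurableSet
  have mO := G.isOpen_ΩO.measurableSet
  obtain ⟨iu, -, du⟩ := hu.hasDerivAt_setIntegral G.bounded_u mu subset_rfl hid ht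
  obtain ⟨iv, -, dv⟩ := hv.hasDerivAt_setIntegral G.bounded_v mv subset_rfl hid ht
  have duO := (hu.hasDerivAt_setIntegral G.bounded_u mO inter_subset_left hid ht).2.2
  have dvO := (hv.hasDerivAt_setIntegral G.bounded_v mO inter_subset_right hid ht).2.2
  have D := (du.add dv).sub ((duO.const_smul η).add (dvO.const_smul (1 - η)))
  -- Differentiability is already in `D`. Its value is found by pairing with each `c` and comparing,
  -- by uniqueness of derivatives, with the scalar balance for the constant multiplier `c`.
  refine HasDerivAt.congr_deriv (f := totalState G u v η) D (ext_inner_left ℝ fun c => ?_)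
  have h1 := (innerSL ℝ c).hasFDerivAt.comp_hasDerivAt t D
  have h2 := hsol.hasDerivAt_totalDensity (L.isCompanionLaw_inner c) (h𝒯u.const_mem c)
    (h𝒯v.const_mem c) η ht
  have heq : totalDensity G u v (fun ω => inner ℝ c ω) η =ᶠ[𝓝 t]
      fun τ => inner ℝ c (totalState G u v η τ) := by
    filter_upwards [iu, iv] with τ h1 h2 using (inner_totalState c η h1 h2).symm
  refine (h1.unique (h2.congr_of_eventuallyEq heq.symm)).trans ?_
  rw [interior_const_eq_zero fun m => hcoupling m t ht, inner_neg_right,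
    inner_boundaryFlux hu hv c ht]
  simp only [← inner_interfaceFlux]
  rw [integral_eq_zero_of_ae ((hC t ht).1.mono fun x hx => by simp [hx]),
    integral_eq_zero_of_ae ((hC t ht).2.mono fun x hx => by simp [hx])]
  ring

theorem continuousOn_boundaryEntropyFlux (hu : IsRegular L T G.Ωu u) (hv : IsRegular L T G.Ωv v) :
    ContinuousOn (boundaryEntropyFlux L G u v) (Icc 0 T) := by
  refine ContinuousOn.add ?_ ?_
  · exact G.normal_u.continuousOn_integral_normalComp G.Γa_subset G.isCompact_Γa isCompact_Icc
      (g := fun t x i => L.fε i (u t x)) fun i z hz => (hu.contDiffAt_comp (L.contDiffOn_fε i) hz.1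
        (G.Γa_subset_closure hz.2)).continuousAt.continuousWithinAt
  · exact G.normal_v.continuousOn_integral_normalComp G.Γd_subset G.isCompact_Γd isCompact_Icc
      (g := fun t x i => L.fε i (v t x)) fun i z hz => (hv.contDiffAt_comp (L.contDiffOn_fε i) hz.1
        (G.Γd_subset_closure hz.2)).continuousAt.continuousWithinAt

end Balance

/-! ### Entropy conserving two-point fluxes -/

section TwoPoint

variable {d p : ℕ} {L : EntropySystem d p} {fec : Fin d → State p → State p → State p}

/-- In each direction the penalties contribute `β` times `(w_a - w_c)ᵀ fec - (w_aᵀ f(a) - w_cᵀ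
f(c))`, which the Tadmor condition identifies as minus the jump of `fε`. -/
theorem interfaceEntropy_eq_zero (hfec : IsEntropyConservingFlux L fec) (β : ℝ) (n : Space d)
    {Pu Pv : Fin d → State p → State p → State p} {a c : State p} (ha : a ∈ L.adm) (hc : c ∈ L.adm)
    (hPu : ∀ i, Pu i a c = β • (fec i a c - L.f i a))
    (hPv : ∀ i, Pv i a c = -(β • (fec i a c - L.f i c))) :
    interfaceEntropy L β n Pu Pv a c = 0 := by
  simp only [interfaceEntropy, inner_normalComp]
  simp only [normalComp, ← Finset.sum_add_distrib]
  refine Finset.sum_eq_zero fun i _ => ?_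
  rw [hPu, hPv, hfec.jump i a ha c hc]
  simp only [inner_neg_right, inner_smul_right, inner_sub_right, inner_sub_left, PiLp.smul_apply,
    smul_eq_mul]
  ring

theorem interfaceFlux_eq_zero (β : ℝ) (n : Space d)
    {Pu Pv : Fin d → State p → State p → State p} {a c : State p}
    (hPu : ∀ i, Pu i a c = β • (fec i a c - L.f i a))
    (hPv : ∀ i, Pv i a c = -(β • (fec i a c - L.f i c))) :
    interfaceFlux L β n Pu Pv a c = 0 := by
  simp only [interfaceFlux, normalComp, ← Finset.sum_add_distrib]
  refine Finset.sum_eq_zero fun i _ => ?_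
  rw [hPu, hPv, PiLp.smul_apply, smul_eq_mul]
  module

end TwoPoint

end Overset

/-! ### Assembly of the five claims -/

open Overset

theorem mainTheorem3 {d p : ℕ} (L : EntropySystem d p) (G : Geometry d)
    (P : InterfacePenalties L) (Q : InteriorPenalties p G)
    (η : ℝ) (hη0 : 0 < η) (hη1 : η < 1) (T : ℝ) (hT : 0 < T)
    (hSu : ∀ m, ∀ t ∈ Set.Icc 0 T, IsPosDef (Q.Su m t))
    (hSv : ∀ m, ∀ t ∈ Set.Icc 0 T, IsPosDef (Q.Sv m t))
    (hcoupling : ∀ m, ∀ t ∈ Set.Icc 0 T, (1 - η) • Q.Su m t = η • Q.Sv m t)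
    (𝒯u 𝒯v : Submodule ℝ (ℝ → Space d → State p))
    (h𝒯u : IsTestSpace T G.Ωu 𝒯u) (h𝒯v : IsTestSpace T G.Ωv 𝒯v)
    (u v : ℝ → Space d → State p)
    (hsol : IsWeakSolution L G P Q u v T 𝒯u 𝒯v)
    (hwu : (fun t x => L.w (u t x)) ∈ 𝒯u) (hwv : (fun t x => L.w (v t x)) ∈ 𝒯v) :
    -- each dissipation term is a nonnegative quadratic form in the jump
    (∀ t ∈ Set.Icc 0 T, ∀ m,
      pointDissipation L G Q u v η t m =
        (1 - η) * inner ℝ (L.w (u t (Q.pt m)) - L.w (v t (Q.pt m)))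
          (act (Q.Su m t) (L.w (u t (Q.pt m)) - L.w (v t (Q.pt m)))) ∧
      0 ≤ pointDissipation L G Q u v η t m) ∧
    -- the entropy bound
    (InterfaceEntropyBounded L G P u v T η →
      (∀ t ∈ Set.Icc 0 T, ∃ S' : ℝ, HasDerivAt (totalEntropy L G u v η) S' t ∧
        S' + dissipation L G Q u v η t ≤ -boundaryEntropyFlux L G u v t ∧
        S' ≤ -boundaryEntropyFlux L G u v t) ∧
      (∀ t ∈ Set.Icc 0 T, totalEntropy L G u v η t ≤
        totalEntropy L G u v η 0 - ∫ τ in (0 : ℝ)..t, boundaryEntropyFlux L G u v τ) ∧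
      ((∀ t ∈ Set.Icc 0 T, 0 ≤ boundaryEntropyFlux L G u v t) →
        ∀ t ∈ Set.Icc 0 T, totalEntropy L G u v η t ≤ totalEntropy L G u v η 0)) ∧
    -- the entropy balance, and entropy conservation when all dissipation terms vanish
    (InterfaceEntropyConserving L G P u v T η →
      ∀ t ∈ Set.Icc 0 T,
        HasDerivAt (totalEntropy L G u v η)
          (-boundaryEntropyFlux L G u v t - dissipation L G Q u v η t) t ∧
        ((∀ m, pointDissipation L G Q u v η t m = 0) →
          HasDerivAt (totalEntropy L G u v η) (-boundaryEntropyFlux L G u v t) t)) ∧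
    -- conservation
    (InterfaceConservative L G P u v T η →
      ∀ t ∈ Set.Icc 0 T,
        HasDerivAt (totalState G u v η) (-boundaryFlux L G u v t) t) ∧
    -- penalties built from an entropy conserving flux satisfy all the interface conditions
    (∀ fec : Fin d → State p → State p → State p, IsEntropyConservingFlux L fec →
      P.IsBuiltFrom η fec →
        InterfaceEntropyBounded L G P u v T η ∧
        InterfaceEntropyConserving L G P u v T η ∧
        InterfaceConservative L G P u v T η) := by
  have hD : ∀ t ∈ Set.Icc 0 T, ∀ m, 0 ≤ pointDissipation L G Q u v η t m := fun t ht m => by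
    rw [pointDissipation_eq (hcoupling m t ht)]
    exact mul_nonneg (by linarith) ((hSu m t ht).inner_act_nonneg _)
  -- This includes `M = 0`: then `1 / 0 = 0` and the sum is empty.
  have hdiss : ∀ t ∈ Set.Icc 0 T, 0 ≤ dissipation L G Q u v η t := fun t ht =>
    mul_nonneg (by positivity) (Finset.sum_nonneg fun m _ => hD t ht m)
  have hS := fun t (ht : t ∈ Set.Icc 0 T) => hsol.hasDerivAt_totalEntropy hwu hwv η ht
  refine ⟨fun t ht m => ⟨pointDissipation_eq (hcoupling m t ht), hD t ht m⟩, fun hB => ?_,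
    fun hB t ht => ?_, fun hC t ht => hsol.hasDerivAt_totalState h𝒯u h𝒯v hcoupling hC ht,
    fun fec hfec hP => ?_⟩
  · have hrate : ∀ t ∈ Set.Icc 0 T, ∃ S' : ℝ, HasDerivAt (totalEntropy L G u v η) S' t ∧
        S' + dissipation L G Q u v η t ≤ -boundaryEntropyFlux L G u v t ∧
        S' ≤ -boundaryEntropyFlux L G u v t := fun t ht => by
      have hb := integral_nonneg_of_ae (hB t ht).1
      have hc := integral_nonneg_of_ae (hB t ht).2
      have hd := hdiss t ht
      exact ⟨_, hS t ht, by linarith, by linarith⟩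
    have hcont := continuousOn_boundaryEntropyFlux hsol.regular_u hsol.regular_v
    have hbound : ∀ t ∈ Set.Icc 0 T, totalEntropy L G u v η t ≤
        totalEntropy L G u v η 0 - ∫ τ in (0 : ℝ)..t, boundaryEntropyFlux L G u v τ :=
      fun t ht => by
      have hsub : Set.Icc 0 t ⊆ Set.Icc 0 T := Set.Icc_subset_Icc_right ht.2
      choose! S' hS' using hrate
      -- The comparison theorem requires integrability only of the upper bound `-Fε`, which is
      -- continuous; nothing about the chosen rate `S'` as a function of time is needed.
      have := intervalIntegral.sub_le_integral_of_hasDeriv_right_of_le ht.1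
        (fun τ hτ => (hS' τ (hsub hτ)).1.continuousAt.continuousWithinAt)
        (fun τ hτ => (hS' τ (hsub (Set.Ioo_subset_Icc_self hτ))).1.hasDerivWithinAt)
        (hcont.mono hsub).neg.integrableOn_Icc
        (fun τ hτ => (hS' τ (hsub (Set.Ioo_subset_Icc_self hτ))).2.2)
      simp only [Pi.neg_apply, intervalIntegral.integral_neg] at this
      linarith
    refine ⟨hrate, hbound, fun hF t ht => (hbound t ht).trans ?_⟩
    have := intervalIntegral.integral_nonneg (μ := volume) ht.1 fun τ hτ => hF τ ⟨hτ.1, hτ.2.trans ht.2⟩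
    linarith
  · have h := hS t ht
    rw [integral_eq_zero_of_ae (hB t ht).1, integral_eq_zero_of_ae (hB t ht).2, sub_zero,
      sub_zero] at h
    refine ⟨h, fun h0 => ?_⟩
    rwa [show dissipation L G Q u v η t = 0 by simp [dissipation, h0], sub_zero] at h
  · have hu : ∀ t ∈ Set.Icc 0 T, ∀ x ∈ closure G.ΩO, u t x ∈ L.adm := fun t ht =>
      (hsol.regular_u.mono Set.inter_subset_left).mapsTo ht
    have hv : ∀ t ∈ Set.Icc 0 T, ∀ x ∈ closure G.ΩO, v t x ∈ L.adm := fun t ht =>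
      (hsol.regular_v.mono Set.inter_subset_right).mapsTo ht
    have mb : MeasurableSet G.Γb := G.isCompact_Γb.measurableSet
    have mc : MeasurableSet G.Γc := G.isCompact_Γc.measurableSet
    have cb := G.Γb_subset_closure_ΩO
    have cc := G.Γc_subset_closure_ΩO
    have hE : InterfaceEntropyConserving L G P u v T η := fun t ht =>
      ⟨(ae_restrict_mem mb).mono fun x hx => interfaceEntropy_eq_zero hfec _ _ (hu t ht x (cb hx))
          (hv t ht x (cb hx))
          (fun i => (hP i _ (hu t ht x (cb hx)) _ (hv t ht x (cb hx))).1)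
          fun i => (hP i _ (hu t ht x (cb hx)) _ (hv t ht x (cb hx))).2.1,
        (ae_restrict_mem mc).mono fun x hx => interfaceEntropy_eq_zero hfec _ _ (hu t ht x (cc hx))
          (hv t ht x (cc hx))
          (fun i => (hP i _ (hu t ht x (cc hx)) _ (hv t ht x (cc hx))).2.2.1)
          fun i => (hP i _ (hu t ht x (cc hx)) _ (hv t ht x (cc hx))).2.2.2⟩
    refine ⟨fun t ht => ⟨(hE t ht).1.mono fun x hx => hx.ge, (hE t ht).2.mono fun x hx => hx.ge⟩,
      hE, fun t ht => ⟨(ae_restrict_mem mb).mono fun x hx => ?_,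
        (ae_restrict_mem mc).mono fun x hx => ?_⟩⟩
    · exact interfaceFlux_eq_zero (fec := fec) _ _
        (fun i => (hP i _ (hu t ht x (cb hx)) _ (hv t ht x (cb hx))).1)
        fun i => (hP i _ (hu t ht x (cb hx)) _ (hv t ht x (cb hx))).2.1
    · exact interfaceFlux_eq_zero (fec := fec) _ _
        (fun i => (hP i _ (hu t ht x (cc hx)) _ (hv t ht x (cc hx))).2.2.1)
        fun i => (hP i _ (hu t ht x (cc hx)) _ (hv t ht x (cc hx))).2.2.2
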